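/- **Conventions.** A locale $X$ is given by its frame $O(X)$ and a locale map $f:X\to Y$ by a frame map $f^*:O(Y)\to O(X)$. The map $f$ is *semiopen* if $f^*$ preserves arbitrary meets, so that $f^*$ has a left adjoint $f_!$; it is *open* if moreover $f_!(a\wedge f^*(b))=f_!(a)\wedge b$ for all $a,b$; it is *étale* (a local homeomorphism) if it is open and there is $S\subseteq O(X)$ with $\bigvee S=1$ such that for each $c\in S$ the map $O(Y)\to c^{\downarrow}$, $x\mapsto f^*(x)\wedge c$, is surjective. A *localic category* $C=(C_1,C_0,u,d,r,m)$ is an internal category in locales, with unit $u:C_0\to C_1$, domain and codomain $d,r:C_1\to C_0$ and multiplication $m:C_1\times_{C_0}C_1\to C_1$, where $C_1\times_{C_0}C_1$ is the pullback of $d$ (first factor) and $r$ (second factor). It is *quantal* if $d,r,u$ are open and $m$ is semiopen, and *étale* if $u,m$ are open and $d,r$ are étale. An *Ehresmann quantal frame* is a frame $Q$ with an associative multiplication distributing over arbitrary joins on both sides, a unit $e$, and join-preserving maps $\lambda,\rho:Q\to e^{\downarrow}$ such that $\lambda(a)=\rho(a)=a$ for $a\le e$, $\rho(a)a=a=a\lambda(a)$,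 $\lambda(ab)=\lambda(\lambda(a)b)$ and $\rho(ab)=\rho(a\rho(b))$. An element $a\in Q$ is a *partial isometry* if every $b\le a$ satisfies $b=af=ga$ for some $f,g\le e$. $Q$ is *étale* if its top element $1$ is a join of partial isometries, and a *restriction quantal frame* if it is étale and its partial isometries are closed under multiplication. Put $u^*(a)=a\wedge e$, $d^*(f)=1f$, $r^*(f)=f1$ for $a\in Q$, $f\le e$, and let $m^*:Q\to Q\otimes_{e^{\downarrow}}Q$, $m^*(a)=\bigvee_{xy\le a}x\otimes y$, be the right adjoint of the map $x\otimes y\mapsto xy$, where $Q\otimes_{e^{\downarrow}}Q$ is the pushout of the frame maps $d^*$ and $r^*$. $Q$ is *multiplicative* if $m^*$ preserves arbitrary joins; then $\mathcal C(Q)$ denotes $C_1,C_0$ with $O(C_1)=Q$, $O(C_0)=e^{\downarrow}$ together with the locale maps $u,d,r,m$. $Q$ is *strongly multiplicative* if it is multiplicative and the multiplication $m$ of $\mathcal C(Q)$ is open. For a quantal localic category $C$, $\mathcal O(C)$ denotes the frame $O(C_1)$ with $ab=m_!(a\otimes b)$, $e=u_!(1)$, $\lambda=u_!d_!$, $\rho=u_!r_!$.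 **Theorem (Etale Correspondence Theorem).** The constructions $Q\mapsto\mathcal C(Q)$ and $C\mapsto\mathcal O(C)$ give a bijective correspondence (up to isomorphism) between restriction quantal frames and étale localic categories. Precisely: 1. If $Q$ is an étale Ehresmann quantal frame, then the set of partial isometries of $Q$ is closed under multiplication if and only if $Q$ is strongly multiplicative. 2. An Ehresmann quantal frame $Q$ is a restriction quantal frame if and only if it is multiplicative and $\mathcal C(Q)$ is an étale localic category. 3. A quantal localic category $C$ is étale if and only if $\mathcal O(C)$ is a restriction quantal frame. 4. $\mathcal O(\mathcal C(Q))=Q$ for every restriction quantal frame $Q$. 5. For every étale localic category $C$, $\mathcal O(C)$ is a multiplicative Ehresmann quantal frame and $\mathcal C(\mathcal O(C))$ is isomorphic to $C$ by an invertible internal functor. 6. For restriction quantal frames $Q,R$: $Q\cong R$ if and only if $\mathcal C(Q)\cong\mathcal C(R)$; for étale localic categories $C,D$: $C\cong D$ if and only if $\mathcal O(C)\cong\mathcal O(D)$. -/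

import Mathlib

universe u

noncomputable section

/-! ## Locale maps

A locale `X` is represented by its frame `O(X)`, and a locale map `f : X → Y` by the frame
homomorphism `f^* : O(Y) → O(X)`, that is by a term of `FrameHom (O Y) (O X)`. -/

namespace LocaleMap

variable {L M : Type u} [Order.Frame L] [Order.Frame M]

/-- The direct image `f_!` of a locale map. It is the left adjoint of `f^*` as soon as `f` is
semiopen. -/
def directImage (f : FrameHom M L) (a : L) : M := sInf {b | a ≤ f b}

/-- A locale map is semiopen if its inverse image map preserves arbitrary meets. -/
def IsSemiopen (f : FrameHom M L) : Prop := ∀ S : Set M, f (sInf S) = sInf (f '' S)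

theorem directImage_gc {f : FrameHom M L} (hf : IsSemiopen f) :
    GaloisConnection (directImage f) f := by
  intro a b
  constructor
  · intro h
    have h1 : a ≤ f (sInf {b | a ≤ f b}) := by
      rw [hf]
      refine le_sInf ?_
      rintro _ ⟨c, hc, rfl⟩
      exact hc
    exact h1.trans (OrderHomClass.mono f h)
  · intro h
    exact sInf_le h

/-- A locale map is open if it is semiopen and satisfies the Frobenius condition. -/
def IsOpenMap (f : FrameHom M L) : Prop :=
  IsSemiopen f ∧ ∀ (a : L) (b : M), directImage f (a ⊓ f b) = directImage f a ⊓ b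

/-- A local homeomorphism (étale map) of locales: an open map `f : L → M` for which there is a
cover `S` of `L` such that `x ↦ f^* x ⊓ c` maps `O(M)` onto `c^↓` for every `c ∈ S`. -/
def IsEtaleMap (f : FrameHom M L) : Prop :=
  IsOpenMap f ∧ ∃ S : Set L, sSup S = ⊤ ∧ ∀ c ∈ S, ∀ a ≤ c, ∃ x : M, f x ⊓ c = a

end LocaleMap

/-! ## Pullbacks of locales, that is pushouts of frames -/

/-- The pushout `A ⊗_L B` of frames along `f : L → A` and `g : L → B`. Its elements are the
lower sets of `A × B` that are closed under joins in each variable and under the relation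
`(a ⊓ f l) ⊗ b = a ⊗ (g l ⊓ b)`. -/
@[ext]
structure FrameTensor {L A B : Type u} [Order.Frame L] [Order.Frame A] [Order.Frame B]
    (f : FrameHom L A) (g : FrameHom L B) : Type u where
  carrier : Set (A × B)
  lower : ∀ {a a' : A} {b b' : B}, a' ≤ a → b' ≤ b → (a, b) ∈ carrier → (a', b') ∈ carrier
  sSup_left : ∀ (S : Set A) (b : B), (∀ a ∈ S, (a, b) ∈ carrier) → (sSup S, b) ∈ carrier
  sSup_right : ∀ (a : A) (S : Set B), (∀ b ∈ S, (a, b) ∈ carrier) → (a, sSup S) ∈ carrier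
  balanced : ∀ (a : A) (l : L) (b : B), (a ⊓ f l, b) ∈ carrier ↔ (a, g l ⊓ b) ∈ carrier

namespace FrameTensor

variable {L A B : Type u} [Order.Frame L] [Order.Frame A] [Order.Frame B]
variable {f : FrameHom L A} {g : FrameHom L B}

instance : PartialOrder (FrameTensor f g) :=
  PartialOrder.lift carrier fun _ _ h => FrameTensor.ext h

instance : InfSet (FrameTensor f g) where
  sInf 𝒮 :=
    { carrier := {p | ∀ I ∈ 𝒮, p ∈ I.carrier}
      lower := fun ha hb h I hI => I.lower ha hb (h I hI)
      sSup_left := fun S b h I hI => I.sSup_left S b fun a ha => h a ha I hI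
      sSup_right := fun a S h I hI => I.sSup_right a S fun b hb => h b hb I hI
      balanced := fun a l b => forall₂_congr fun I _ => I.balanced a l b }

instance : CompleteLattice (FrameTensor f g) :=
  { completeLatticeOfInf (FrameTensor f g) (fun _ =>
      ⟨fun I hI _ hp => hp I hI, fun _ hJ _ hp _ hI => hJ hI hp⟩) with
    inf := fun I J =>
      { carrier := I.carrier ∩ J.carrier
        lower := fun ha hb h => ⟨I.lower ha hb h.1, J.lower ha hb h.2⟩
        sSup_left := fun S b h =>
          ⟨I.sSup_left S b fun a ha => (h a ha).1, J.sSup_left S b fun a ha => (h a ha).2⟩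
        sSup_right := fun a S h =>
          ⟨I.sSup_right a S fun b hb => (h b hb).1, J.sSup_right a S fun b hb => (h b hb).2⟩
        balanced := fun a l b => and_congr (I.balanced a l b) (J.balanced a l b) }
    inf_le_left := fun _ _ _ hp => hp.1
    inf_le_right := fun _ _ _ hp => hp.2
    le_inf := fun _ _ _ h₁ h₂ _ hp => ⟨h₁ hp, h₂ hp⟩
    top :=
      { carrier := Set.univ
        lower := fun _ _ _ => trivial
        sSup_left := fun _ _ _ => trivial
        sSup_right := fun _ _ _ => trivial
        balanced := fun _ _ _ => Iff.rfl }
    le_top := fun _ _ _ => trivial }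

/-- `{p | p ⊓ (x, y) ∈ K}`. -/
def div (K : FrameTensor f g) (x : A) (y : B) : FrameTensor f g where
  carrier := {p | (p.1 ⊓ x, p.2 ⊓ y) ∈ K.carrier}
  lower := fun ha hb h => K.lower (inf_le_inf_right _ ha) (inf_le_inf_right _ hb) h
  sSup_left := by
    intro S b h
    change (sSup S ⊓ x, b ⊓ y) ∈ K.carrier
    rw [sSup_inf_eq, ← sSup_image]
    refine K.sSup_left _ _ ?_
    rintro _ ⟨a, ha, rfl⟩
    exact h a ha
  sSup_right := by
    intro a S h
    change (a ⊓ x, sSup S ⊓ y) ∈ K.carrier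
    rw [sSup_inf_eq, ← sSup_image]
    refine K.sSup_right _ _ ?_
    rintro _ ⟨b, hb, rfl⟩
    exact h b hb
  balanced := by
    intro a l b
    change (a ⊓ f l ⊓ x, b ⊓ y) ∈ K.carrier ↔ (a ⊓ x, g l ⊓ b ⊓ y) ∈ K.carrier
    rw [inf_right_comm a, K.balanced, inf_assoc (g l)]

theorem inf_le_iff (I J K : FrameTensor f g) :
    J ⊓ I ≤ K ↔ J ≤ sInf {D | ∃ p ∈ I.carrier, D = div K p.1 p.2} := by
  constructor
  · rintro h p hp _ ⟨q, hq, rfl⟩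
    exact h ⟨J.lower inf_le_left inf_le_left hp, I.lower inf_le_right inf_le_right hq⟩
  · rintro h ⟨a, b⟩ ⟨hJ, hI⟩
    have : (a ⊓ a, b ⊓ b) ∈ K.carrier := h hJ (div K a b) ⟨(a, b), hI, rfl⟩
    simpa using this

instance : Order.Frame (FrameTensor f g) :=
  Order.Frame.ofMinimalAxioms
    { inf_sSup_le_iSup_inf := by
        intro I 𝒮
        rw [inf_comm, inf_le_iff]
        refine sSup_le fun J hJ => ?_
        rw [← inf_le_iff, inf_comm]
        exact le_iSup₂ (f := fun b _ => I ⊓ b) J hJ }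

/-- The pure tensor `a ⊗ b`. -/
def tmul (f : FrameHom L A) (g : FrameHom L B) (a : A) (b : B) : FrameTensor f g :=
  sInf {I | (a, b) ∈ I.carrier}

theorem tmul_le {a : A} {b : B} {I : FrameTensor f g} :
    tmul f g a b ≤ I ↔ (a, b) ∈ I.carrier :=
  ⟨fun h => h (fun _ hJ => hJ), fun h => sInf_le h⟩

theorem mem_tmul (a : A) (b : B) : (a, b) ∈ (tmul f g a b).carrier := tmul_le.1 le_rfl

theorem tmul_mono {a a' : A} {b b' : B} (ha : a' ≤ a) (hb : b' ≤ b) :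
    tmul f g a' b' ≤ tmul f g a b :=
  tmul_le.2 ((tmul f g a b).lower ha hb (mem_tmul a b))

theorem tmul_inf (a a' : A) (b b' : B) :
    tmul f g a b ⊓ tmul f g a' b' = tmul f g (a ⊓ a') (b ⊓ b') := by
  apply le_antisymm
  · rw [inf_le_iff, tmul_le]
    rintro _ ⟨⟨x, y⟩, hxy, rfl⟩
    have h : tmul f g a' b' ≤ div (tmul f g (a ⊓ a') (b ⊓ b')) a b := by
      rw [tmul_le]
      change (a' ⊓ a, b' ⊓ b) ∈ (tmul f g (a ⊓ a') (b ⊓ b')).carrier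
      rw [inf_comm a', inf_comm b']
      exact mem_tmul _ _
    have h2 : (x ⊓ a, y ⊓ b) ∈ (tmul f g (a ⊓ a') (b ⊓ b')).carrier := h hxy
    rw [inf_comm x, inf_comm y] at h2
    exact h2
  · exact le_inf (tmul_mono inf_le_left inf_le_left) (tmul_mono inf_le_right inf_le_right)

theorem tmul_top_top : tmul f g ⊤ ⊤ = ⊤ :=
  top_le_iff.1 fun _ _ => (tmul f g ⊤ ⊤).lower le_top le_top (mem_tmul _ _)

theorem tmul_balanced (a : A) (l : L) (b : B) : tmul f g (a ⊓ f l) b = tmul f g a (g l ⊓ b) :=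
  le_antisymm (tmul_le.2 (((tmul f g a (g l ⊓ b)).balanced a l b).2 (mem_tmul _ _)))
    (tmul_le.2 (((tmul f g (a ⊓ f l) b).balanced a l b).1 (mem_tmul _ _)))

/-- The inverse image `a ↦ a ⊗ 1` of the first projection `π₁`. -/
def fst (f : FrameHom L A) (g : FrameHom L B) : FrameHom A (FrameTensor f g) where
  toFun a := tmul f g a ⊤
  map_inf' a a' := by rw [tmul_inf, inf_top_eq]
  map_top' := tmul_top_top
  map_sSup' S := by
    apply le_antisymm
    · refine tmul_le.2 ((sSup ((fun a => tmul f g a ⊤) '' S)).sSup_left S ⊤ fun a ha => ?_)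
      exact tmul_le.1 (le_sSup ⟨a, ha, rfl⟩)
    · refine sSup_le ?_
      rintro _ ⟨a, ha, rfl⟩
      exact tmul_mono (le_sSup ha) le_rfl

/-- The inverse image `b ↦ 1 ⊗ b` of the second projection `π₂`. -/
def snd (f : FrameHom L A) (g : FrameHom L B) : FrameHom B (FrameTensor f g) where
  toFun b := tmul f g ⊤ b
  map_inf' b b' := by rw [tmul_inf, inf_top_eq]
  map_top' := tmul_top_top
  map_sSup' S := by
    apply le_antisymm
    · refine tmul_le.2 ((sSup ((fun b => tmul f g ⊤ b) '' S)).sSup_right ⊤ S fun b hb => ?_)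
      exact tmul_le.1 (le_sSup ⟨b, hb, rfl⟩)
    · refine sSup_le ?_
      rintro _ ⟨b, hb, rfl⟩
      exact tmul_mono le_rfl (le_sSup hb)

theorem fst_apply (a : A) : fst f g a = tmul f g a ⊤ := rfl

theorem snd_apply (b : B) : snd f g b = tmul f g ⊤ b := rfl

theorem fst_inf_snd (a : A) (b : B) : fst f g a ⊓ snd f g b = tmul f g a b := by
  rw [fst_apply, snd_apply, tmul_inf, inf_top_eq, top_inf_eq]

/-- The pushout square commutes. -/
theorem fst_comp_eq_snd_comp : (fst f g).comp f = (snd f g).comp g := by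
  ext l : 1
  have h := tmul_balanced (f := f) (g := g) ⊤ l ⊤
  rw [top_inf_eq, inf_top_eq] at h
  exact h

section lift

variable {N : Type u} [Order.Frame N] (h : FrameHom A N) (k : FrameHom B N)

/-- The right adjoint of the map out of the pushout induced by `h` and `k`. -/
def liftAdj (w : h.comp f = k.comp g) (n : N) : FrameTensor f g where
  carrier := {p | h p.1 ⊓ k p.2 ≤ n}
  lower := fun ha hb hn =>
    (inf_le_inf (OrderHomClass.mono h ha) (OrderHomClass.mono k hb)).trans hn
  sSup_left := by
    intro S b hS
    change h (sSup S) ⊓ k b ≤ n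
    rw [map_sSup, sSup_inf_eq]
    refine iSup₂_le ?_
    rintro _ ⟨a, ha, rfl⟩
    exact hS a ha
  sSup_right := by
    intro a S hS
    change h a ⊓ k (sSup S) ≤ n
    rw [map_sSup, inf_sSup_eq]
    refine iSup₂_le ?_
    rintro _ ⟨b, hb, rfl⟩
    exact hS b hb
  balanced := by
    intro a l b
    change h (a ⊓ f l) ⊓ k b ≤ n ↔ h a ⊓ k (g l ⊓ b) ≤ n
    have e : h (f l) = k (g l) := DFunLike.congr_fun w l
    rw [map_inf, map_inf, e, inf_assoc]

theorem lift_gc (w : h.comp f = k.comp g) :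
    GaloisConnection
      (fun I : FrameTensor f g => sSup ((fun p : A × B => h p.1 ⊓ k p.2) '' I.carrier))
      (liftAdj h k w) := by
  intro I n
  constructor
  · intro hI p hp
    exact (le_sSup (Set.mem_image_of_mem (fun p : A × B => h p.1 ⊓ k p.2) hp)).trans hI
  · intro hI
    refine sSup_le ?_
    rintro _ ⟨p, hp, rfl⟩
    exact hI hp

/-- The frame map out of the pushout `A ⊗_L B` induced by `h` and `k`; as a locale map it is the
pairing `⟨h, k⟩` into the pullback. -/
def lift (w : h.comp f = k.comp g) : FrameHom (FrameTensor f g) N where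
  toFun I := sSup ((fun p : A × B => h p.1 ⊓ k p.2) '' I.carrier)
  map_inf' I J := by
    apply le_antisymm
    · exact (lift_gc h k w).monotone_l.map_inf_le I J
    · rw [sSup_inf_sSup]
      refine iSup₂_le ?_
      rintro ⟨_, _⟩ ⟨⟨⟨a, b⟩, hI, rfl⟩, ⟨⟨a', b'⟩, hJ, rfl⟩⟩
      refine le_trans (le_of_eq ?_) (le_sSup ⟨(a ⊓ a', b ⊓ b'),
        ⟨I.lower inf_le_left inf_le_left hI, J.lower inf_le_right inf_le_right hJ⟩, rfl⟩)
      simp only [map_inf]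
      exact inf_inf_inf_comm _ _ _ _
  map_top' := by
    refine top_le_iff.1 (le_sSup ⟨(⊤, ⊤), trivial, ?_⟩)
    simp
  map_sSup' 𝒮 := by
    rw [(lift_gc h k w).l_sSup, sSup_image]

theorem lift_tmul (w : h.comp f = k.comp g) (a : A) (b : B) :
    lift h k w (tmul f g a b) = h a ⊓ k b := by
  apply le_antisymm
  · exact (lift_gc h k w).l_le (tmul_le.2 (le_refl (h a ⊓ k b)))
  · exact le_sSup ⟨(a, b), mem_tmul a b, rfl⟩

theorem lift_comp_fst (w : h.comp f = k.comp g) : (lift h k w).comp (fst f g) = h := by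
  ext a : 1
  change lift h k w (tmul f g a ⊤) = h a
  rw [lift_tmul, map_top, inf_top_eq]

theorem lift_comp_snd (w : h.comp f = k.comp g) : (lift h k w).comp (snd f g) = k := by
  ext b : 1
  change lift h k w (tmul f g ⊤ b) = k b
  rw [lift_tmul, map_top, top_inf_eq]

/-- Uniqueness in the universal property of the pushout. -/
theorem hom_ext {φ ψ : FrameHom (FrameTensor f g) N}
    (h₁ : φ.comp (fst f g) = ψ.comp (fst f g)) (h₂ : φ.comp (snd f g) = ψ.comp (snd f g)) :
    φ = ψ := by
  have key : ∀ a b, φ (tmul f g a b) = ψ (tmul f g a b) := by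
    intro a b
    have e₁ : φ (fst f g a) = ψ (fst f g a) := DFunLike.congr_fun h₁ a
    have e₂ : φ (snd f g b) = ψ (snd f g b) := DFunLike.congr_fun h₂ b
    rw [← fst_inf_snd, map_inf, map_inf, e₁, e₂]
  ext I : 1
  have hI : I = sSup ((fun p : A × B => tmul f g p.1 p.2) '' I.carrier) := by
    apply le_antisymm
    · intro p hp
      exact tmul_le.1 (le_sSup (Set.mem_image_of_mem (fun p : A × B => tmul f g p.1 p.2) hp))
    · refine sSup_le ?_
      rintro _ ⟨p, hp, rfl⟩
      exact tmul_le.2 hp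
  rw [hI, map_sSup, map_sSup, Set.image_image, Set.image_image]
  simp only [key]

end lift

section map

variable {L' A' B' : Type u} [Order.Frame L'] [Order.Frame A'] [Order.Frame B']
variable {f' : FrameHom L' A'} {g' : FrameHom L' B'}

/-- The inverse image of the product `p × q` of two locale maps over `s`. -/
def map (p : FrameHom A A') (q : FrameHom B B') (s : FrameHom L L')
    (hp : p.comp f = f'.comp s) (hq : q.comp g = g'.comp s) :
    FrameHom (FrameTensor f g) (FrameTensor f' g') :=
  lift ((fst f' g').comp p) ((snd f' g').comp q) (by
    rw [FrameHom.comp_assoc, FrameHom.comp_assoc, hp, hq, ← FrameHom.comp_assoc,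
      ← FrameHom.comp_assoc, fst_comp_eq_snd_comp])

end map

end FrameTensor

/-! ## Localic categories -/

/-- The data `(C₁, C₀, u, d, r, m)` underlying a localic category: the frames `Arr = O(C₁)` and
`Obj = O(C₀)` and the inverse image maps of the unit, domain, codomain and multiplication. The
locale `C₁ ×_{C₀} C₁` is the pullback of `d` (first factor) and `r` (second factor). -/
structure LocalicCatData : Type (u + 1) where
  Arr : Type u
  Obj : Type u
  [frameArr : Order.Frame Arr]
  [frameObj : Order.Frame Obj]
  u : FrameHom Arr Obj
  d : FrameHom Obj Arr
  r : FrameHom Obj Arr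
  m : FrameHom Arr (FrameTensor d r)

namespace LocalicCatData

open FrameTensor LocaleMap

instance (C : LocalicCatData.{u}) : Order.Frame C.Arr := C.frameArr
instance (C : LocalicCatData.{u}) : Order.Frame C.Obj := C.frameObj

variable (C : LocalicCatData.{u})

/-- `O(C₁ ×_{C₀} C₁)`. -/
abbrev Pairs : Type u := FrameTensor C.d C.r

/-- `π₁ : C₁ ×_{C₀} C₁ → C₁`. -/
abbrev π₁ : FrameHom C.Arr C.Pairs := fst C.d C.r

/-- `π₂ : C₁ ×_{C₀} C₁ → C₁`. -/
abbrev π₂ : FrameHom C.Arr C.Pairs := snd C.d C.r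

/-- `O((C₁ ×_{C₀} C₁) ×_{C₀} C₁)`. -/
abbrev TriplesL : Type u := FrameTensor (C.π₂.comp C.d) C.r

/-- `O(C₁ ×_{C₀} (C₁ ×_{C₀} C₁))`. -/
abbrev TriplesR : Type u := FrameTensor C.d (C.π₁.comp C.r)

/-- The map `(C₁ ×_{C₀} C₁) ×_{C₀} C₁ → C₁ ×_{C₀} C₁`, `((x, y), z) ↦ (y, z)`. -/
def lastTwo : FrameHom C.Pairs C.TriplesL :=
  lift ((fst (C.π₂.comp C.d) C.r).comp C.π₂) (snd (C.π₂.comp C.d) C.r) (by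
    rw [FrameHom.comp_assoc, fst_comp_eq_snd_comp])

/-- The canonical isomorphism `(C₁ ×_{C₀} C₁) ×_{C₀} C₁ → C₁ ×_{C₀} (C₁ ×_{C₀} C₁)`,
`((x, y), z) ↦ (x, (y, z))`. -/
def assoc : FrameHom C.TriplesR C.TriplesL :=
  lift ((fst (C.π₂.comp C.d) C.r).comp C.π₁) C.lastTwo (by
    rw [FrameHom.comp_assoc, fst_comp_eq_snd_comp, ← FrameHom.comp_assoc,
      ← FrameHom.comp_assoc, lastTwo, lift_comp_fst])

/-- A localic category: an internal category in the category of locales. All equations are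
written for inverse image maps, so compositions are reversed. -/
structure IsLocalicCategory : Prop where
  /-- `d u = id` -/
  d_u : C.u.comp C.d = FrameHom.id C.Obj
  /-- `r u = id` -/
  r_u : C.u.comp C.r = FrameHom.id C.Obj
  /-- `r m = r π₁` -/
  r_m : C.m.comp C.r = C.π₁.comp C.r
  /-- `d m = d π₂` -/
  d_m : C.m.comp C.d = C.π₂.comp C.d
  /-- `m (u × id) = π₂` on `C₀ ×_{C₀} C₁` -/
  unit_left :
    (map (f' := FrameHom.id C.Obj) (g' := C.r) C.u (FrameHom.id C.Arr) (FrameHom.id C.Obj)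
      (by rw [d_u, FrameHom.comp_id]) (by rw [FrameHom.comp_id, FrameHom.id_comp])).comp C.m
      = snd (FrameHom.id C.Obj) C.r
  /-- `m (id × u) = π₁` on `C₁ ×_{C₀} C₀` -/
  unit_right :
    (map (f' := C.d) (g' := FrameHom.id C.Obj) (FrameHom.id C.Arr) C.u (FrameHom.id C.Obj)
      (by rw [FrameHom.comp_id, FrameHom.id_comp]) (by rw [r_u, FrameHom.comp_id])).comp C.m
      = fst C.d (FrameHom.id C.Obj)
  /-- `m (m × id) = m (id × m)` on `(C₁ ×_{C₀} C₁) ×_{C₀} C₁` -/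
  mul_assoc :
    (map (f' := C.π₂.comp C.d) (g' := C.r) C.m (FrameHom.id C.Arr) (FrameHom.id C.Obj)
      (by rw [d_m, FrameHom.comp_id]) (by rw [FrameHom.comp_id, FrameHom.id_comp])).comp C.m
      = C.assoc.comp
        ((map (f' := C.d) (g' := C.π₁.comp C.r) (FrameHom.id C.Arr) C.m (FrameHom.id C.Obj)
          (by rw [FrameHom.comp_id, FrameHom.id_comp])
          (by rw [r_m, FrameHom.comp_id])).comp C.m)

/-- Quantal localic categories: `d`, `r`, `u` are open and `m` is semiopen. -/
structure IsQuantal : Prop extends C.IsLocalicCategory where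
  d_open : IsOpenMap C.d
  r_open : IsOpenMap C.r
  u_open : IsOpenMap C.u
  m_semiopen : IsSemiopen C.m

/-- Étale localic categories: `u` and `m` are open, `d` and `r` are étale. -/
structure IsEtale : Prop extends C.IsLocalicCategory where
  u_open : IsOpenMap C.u
  m_open : IsOpenMap C.m
  d_etale : IsEtaleMap C.d
  r_etale : IsEtaleMap C.r

variable {C} {D E : LocalicCatData.{u}}

/-- An internal functor `C → D`, given by the inverse image maps of its two components. -/
structure Hom (C D : LocalicCatData.{u}) : Type u where
  f₁ : FrameHom D.Arr C.Arr
  f₀ : FrameHom D.Obj C.Obj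
  /-- `d f₁ = f₀ d` -/
  comm_d : f₁.comp D.d = C.d.comp f₀
  /-- `r f₁ = f₀ r` -/
  comm_r : f₁.comp D.r = C.r.comp f₀
  /-- `u f₀ = f₁ u` -/
  comm_u : f₀.comp D.u = C.u.comp f₁
  /-- `m (f₁ × f₁) = f₁ m` -/
  comm_m : (map f₁ f₁ f₀ comm_d comm_r).comp D.m = C.m.comp f₁

/-- Two localic categories are isomorphic if there are mutually inverse internal functors
between them. -/
def Isomorphic (C D : LocalicCatData.{u}) : Prop :=
  ∃ (F : Hom C D) (G : Hom D C),
    F.f₁.comp G.f₁ = FrameHom.id C.Arr ∧ G.f₁.comp F.f₁ = FrameHom.id D.Arr ∧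
    F.f₀.comp G.f₀ = FrameHom.id C.Obj ∧ G.f₀.comp F.f₀ = FrameHom.id D.Obj

end LocalicCatData

/-! ## Ehresmann quantal frames -/

/-- The data underlying an Ehresmann quantal frame: a frame with a multiplication, an element
`e` and two unary operations `lam`, `rho`. -/
structure QuantalFrameData : Type (u + 1) where
  carrier : Type u
  [frame : Order.Frame carrier]
  mul : carrier → carrier → carrier
  e : carrier
  lam : carrier → carrier
  rho : carrier → carrier

namespace QuantalFrameData

open LocaleMap

instance : CoeSort QuantalFrameData.{u} (Type u) := ⟨carrier⟩

instance (Q : QuantalFrameData.{u}) : Order.Frame Q := Q.frame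

instance (Q : QuantalFrameData.{u}) : Mul Q := ⟨Q.mul⟩

variable (Q : QuantalFrameData.{u})

/-- Ehresmann quantal frames. The projections are the elements below the unit `e`. -/
structure IsEhresmann : Prop where
  mul_assoc : ∀ a b c : Q, a * b * c = a * (b * c)
  e_mul : ∀ a : Q, Q.e * a = a
  mul_e : ∀ a : Q, a * Q.e = a
  mul_sSup : ∀ (a : Q) (S : Set Q), a * sSup S = sSup ((fun b => a * b) '' S)
  sSup_mul : ∀ (S : Set Q) (b : Q), sSup S * b = sSup ((fun a => a * b) '' S)
  lam_le : ∀ a : Q, Q.lam a ≤ Q.e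
  rho_le : ∀ a : Q, Q.rho a ≤ Q.e
  lam_sSup : ∀ S : Set Q, Q.lam (sSup S) = sSup (Q.lam '' S)
  rho_sSup : ∀ S : Set Q, Q.rho (sSup S) = sSup (Q.rho '' S)
  lam_proj : ∀ a ≤ Q.e, Q.lam a = a
  rho_proj : ∀ a ≤ Q.e, Q.rho a = a
  rho_mul_self : ∀ a : Q, Q.rho a * a = a
  mul_lam_self : ∀ a : Q, a * Q.lam a = a
  lam_mul : ∀ a b : Q, Q.lam (a * b) = Q.lam (Q.lam a * b)
  rho_mul : ∀ a b : Q, Q.rho (a * b) = Q.rho (a * Q.rho b)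

/-- The natural partial order of the underlying Ehresmann monoid. -/
def NatLE (a b : Q) : Prop := ∃ f ≤ Q.e, ∃ g ≤ Q.e, a = b * f ∧ a = g * b

/-- Partial isometries. -/
def IsPartialIsometry (a : Q) : Prop := ∀ b ≤ a, Q.NatLE b a

/-- The top element is a join of partial isometries. -/
def IsEtale : Prop := ∃ S : Set Q, (∀ a ∈ S, Q.IsPartialIsometry a) ∧ sSup S = ⊤

/-- Partial isometries are closed under multiplication. -/
def PIClosed : Prop :=
  ∀ a b : Q, Q.IsPartialIsometry a → Q.IsPartialIsometry b → Q.IsPartialIsometry (a * b)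

/-- Restriction quantal frames. -/
structure IsRestriction : Prop extends Q.IsEhresmann where
  etale : Q.IsEtale
  pi_closed : Q.PIClosed

/-- Isomorphism of Ehresmann quantal frames. -/
def Isomorphic (Q R : QuantalFrameData.{u}) : Prop :=
  ∃ φ : Q ≃o R, (∀ a b, φ (a * b) = φ a * φ b) ∧ φ Q.e = R.e ∧
    (∀ a, φ (Q.lam a) = R.lam (φ a)) ∧ (∀ a, φ (Q.rho a) = R.rho (φ a))

/-! ### The localic category of a multiplicative Ehresmann quantal frame -/

/-- The frame `e^↓`. -/
abbrev Proj : Type u := Set.Iic Q.e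

instance : Order.Frame Q.Proj :=
  Order.Frame.ofMinimalAxioms
    { inf_sSup_le_iSup_inf := by
        intro a S
        rw [← sSup_image]
        change (a : Q) ⊓ ((sSup S : Q.Proj) : Q) ≤ ((sSup ((fun b => a ⊓ b) '' S) : Q.Proj) : Q)
        rw [Set.Iic.coe_sSup, Set.Iic.coe_sSup, inf_sSup_eq]
        refine iSup₂_le ?_
        rintro _ ⟨b, hb, rfl⟩
        exact le_sSup ⟨a ⊓ b, ⟨b, hb, rfl⟩, rfl⟩ }

variable {Q}

theorem IsEhresmann.mul_mono (hQ : Q.IsEhresmann) {a a' b b' : Q} (ha : a ≤ a') (hb : b ≤ b') :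
    a * b ≤ a' * b' := by
  have h₁ : a * b ≤ a * b' := by
    have h := hQ.mul_sSup a {b, b'}
    rw [sSup_pair, sup_eq_right.2 hb] at h
    rw [h]
    exact le_sSup ⟨b, by simp, rfl⟩
  have h₂ : a * b' ≤ a' * b' := by
    have h := hQ.sSup_mul {a, a'} b'
    rw [sSup_pair, sup_eq_right.2 ha] at h
    rw [h]
    exact le_sSup ⟨a, by simp, rfl⟩
  exact h₁.trans h₂

theorem IsEhresmann.lam_mono (hQ : Q.IsEhresmann) {a b : Q} (h : a ≤ b) :
    Q.lam a ≤ Q.lam b := by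
  have h' := hQ.lam_sSup {a, b}
  rw [sSup_pair, sup_eq_right.2 h] at h'
  rw [h']
  exact le_sSup ⟨a, by simp, rfl⟩

theorem IsEhresmann.rho_mono (hQ : Q.IsEhresmann) {a b : Q} (h : a ≤ b) :
    Q.rho a ≤ Q.rho b := by
  have h' := hQ.rho_sSup {a, b}
  rw [sSup_pair, sup_eq_right.2 h] at h'
  rw [h']
  exact le_sSup ⟨a, by simp, rfl⟩

theorem IsEhresmann.le_top_mul_iff (hQ : Q.IsEhresmann) {a f : Q} (hf : f ≤ Q.e) :
    a ≤ ⊤ * f ↔ Q.lam a ≤ f := by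
  constructor
  · intro h
    refine (hQ.lam_mono h).trans ?_
    rw [hQ.lam_mul]
    calc Q.lam (Q.lam ⊤ * f) ≤ Q.lam (Q.e * f) :=
          hQ.lam_mono (hQ.mul_mono (hQ.lam_le _) le_rfl)
      _ = f := by rw [hQ.e_mul, hQ.lam_proj f hf]
  · intro h
    calc a = a * Q.lam a := (hQ.mul_lam_self a).symm
      _ ≤ ⊤ * f := hQ.mul_mono le_top h

theorem IsEhresmann.le_mul_top_iff (hQ : Q.IsEhresmann) {a f : Q} (hf : f ≤ Q.e) :
    a ≤ f * ⊤ ↔ Q.rho a ≤ f := by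
  constructor
  · intro h
    refine (hQ.rho_mono h).trans ?_
    rw [hQ.rho_mul]
    calc Q.rho (f * Q.rho ⊤) ≤ Q.rho (f * Q.e) :=
          hQ.rho_mono (hQ.mul_mono le_rfl (hQ.rho_le _))
      _ = f := by rw [hQ.mul_e, hQ.rho_proj f hf]
  · intro h
    calc a = Q.rho a * a := (hQ.rho_mul_self a).symm
      _ ≤ f * ⊤ := hQ.mul_mono h le_top

theorem IsEhresmann.inf_top_mul (hQ : Q.IsEhresmann) (a : Q) {f : Q} (hf : f ≤ Q.e) :
    a ⊓ ⊤ * f = a * f := by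
  apply le_antisymm
  · have h : Q.lam (a ⊓ ⊤ * f) ≤ f := (hQ.le_top_mul_iff hf).1 inf_le_right
    calc a ⊓ ⊤ * f = (a ⊓ ⊤ * f) * Q.lam (a ⊓ ⊤ * f) := (hQ.mul_lam_self _).symm
      _ ≤ a * f := hQ.mul_mono inf_le_left h
  · refine le_inf ?_ (hQ.mul_mono le_top le_rfl)
    calc a * f ≤ a * Q.e := hQ.mul_mono le_rfl hf
      _ = a := hQ.mul_e a

theorem IsEhresmann.mul_top_inf (hQ : Q.IsEhresmann) (a : Q) {f : Q} (hf : f ≤ Q.e) :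
    f * ⊤ ⊓ a = f * a := by
  apply le_antisymm
  · have h : Q.rho (f * ⊤ ⊓ a) ≤ f := (hQ.le_mul_top_iff hf).1 inf_le_left
    calc f * ⊤ ⊓ a = Q.rho (f * ⊤ ⊓ a) * (f * ⊤ ⊓ a) := (hQ.rho_mul_self _).symm
      _ ≤ f * a := hQ.mul_mono h inf_le_right
  · refine le_inf (hQ.mul_mono le_rfl le_top) ?_
    calc f * a ≤ Q.e * a := hQ.mul_mono hf le_rfl
      _ = a := hQ.e_mul a

variable (Q) in
/-- `u^* : a ↦ a ⊓ e`, the right adjoint of the inclusion of `e^↓`. -/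
def unitMap : FrameHom Q Q.Proj where
  toFun a := ⟨a ⊓ Q.e, inf_le_right⟩
  map_inf' a b := Subtype.ext (inf_inf_distrib_right a b Q.e)
  map_top' := Subtype.ext (top_inf_eq _)
  map_sSup' S := by
    apply Subtype.ext
    rw [Set.Iic.coe_sSup, Set.image_image]
    change sSup S ⊓ Q.e = _
    rw [sSup_inf_eq, sSup_image]

/-- `d^* : f ↦ 1 f`, the right adjoint of `lam`. -/
def domMap (hQ : Q.IsEhresmann) : FrameHom Q.Proj Q where
  toFun f := ⊤ * (f : Q)
  map_inf' f g := eq_of_forall_le_iff fun a => by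
    rw [le_inf_iff, hQ.le_top_mul_iff f.2, hQ.le_top_mul_iff g.2, hQ.le_top_mul_iff (f ⊓ g).2]
    exact le_inf_iff
  map_top' := hQ.mul_e ⊤
  map_sSup' S := by
    rw [Set.Iic.coe_sSup, hQ.mul_sSup, Set.image_image]

/-- `r^* : f ↦ f 1`, the right adjoint of `rho`. -/
def ranMap (hQ : Q.IsEhresmann) : FrameHom Q.Proj Q where
  toFun f := (f : Q) * ⊤
  map_inf' f g := eq_of_forall_le_iff fun a => by
    rw [le_inf_iff, hQ.le_mul_top_iff f.2, hQ.le_mul_top_iff g.2, hQ.le_mul_top_iff (f ⊓ g).2]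
    exact le_inf_iff
  map_top' := hQ.e_mul ⊤
  map_sSup' S := by
    rw [Set.Iic.coe_sSup, hQ.sSup_mul, Set.image_image]

/-- The frame `Q ⊗_{e^↓} Q`. -/
abbrev Tensor (hQ : Q.IsEhresmann) : Type u := FrameTensor (domMap hQ) (ranMap hQ)

/-- The map `μ : Q ⊗_{e^↓} Q → Q` induced by the multiplication. -/
def mulMap (hQ : Q.IsEhresmann) (I : Tensor hQ) : Q :=
  sSup ((fun p : Q × Q => p.1 * p.2) '' I.carrier)

/-- The right adjoint `m^*` of `μ`; it sends `a` to the join of all `x ⊗ y` with `x y ≤ a`. -/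
def comulMap (hQ : Q.IsEhresmann) (a : Q) : Tensor hQ where
  carrier := {p | p.1 * p.2 ≤ a}
  lower := fun hx hy h => (hQ.mul_mono hx hy).trans h
  sSup_left := by
    intro S y h
    change sSup S * y ≤ a
    rw [hQ.sSup_mul]
    refine sSup_le ?_
    rintro _ ⟨x, hx, rfl⟩
    exact h x hx
  sSup_right := by
    intro x S h
    change x * sSup S ≤ a
    rw [hQ.mul_sSup]
    refine sSup_le ?_
    rintro _ ⟨y, hy, rfl⟩
    exact h y hy
  balanced := by
    intro x f y
    change (x ⊓ ⊤ * (f : Q)) * y ≤ a ↔ x * ((f : Q) * ⊤ ⊓ y) ≤ a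
    rw [hQ.inf_top_mul x f.2, hQ.mul_top_inf y f.2, hQ.mul_assoc]

theorem mulMap_gc (hQ : Q.IsEhresmann) : GaloisConnection (mulMap hQ) (comulMap hQ) := by
  intro I a
  constructor
  · intro h p hp
    exact (le_sSup (Set.mem_image_of_mem (fun p : Q × Q => p.1 * p.2) hp)).trans h
  · intro h
    refine sSup_le ?_
    rintro _ ⟨p, hp, rfl⟩
    exact h hp

theorem mulMap_tmul (hQ : Q.IsEhresmann) (a b : Q) :
    mulMap hQ (FrameTensor.tmul (domMap hQ) (ranMap hQ) a b) = a * b := by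
  apply le_antisymm
  · exact (mulMap_gc hQ).l_le (FrameTensor.tmul_le.2 (le_refl (a * b)))
  · exact le_sSup ⟨(a, b), FrameTensor.mem_tmul a b, rfl⟩

variable (Q) in
/-- `Q` is multiplicative if `m^*` preserves arbitrary joins. -/
def IsMultiplicative (hQ : Q.IsEhresmann) : Prop :=
  ∀ S : Set Q, comulMap hQ (sSup S) = sSup (comulMap hQ '' S)

/-- For multiplicative `Q` the map `m^*` is a frame map. -/
def multMap (hQ : Q.IsEhresmann) (hm : Q.IsMultiplicative hQ) : FrameHom Q (Tensor hQ) where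
  toFun := comulMap hQ
  map_inf' _ _ := (mulMap_gc hQ).u_inf
  map_top' := (mulMap_gc hQ).u_top
  map_sSup' := hm

/-- The data `𝒞(Q)` of the localic category of a multiplicative Ehresmann quantal frame. -/
abbrev toLocalicCat (hQ : Q.IsEhresmann) (hm : Q.IsMultiplicative hQ) : LocalicCatData.{u} where
  Arr := Q
  Obj := Q.Proj
  u := Q.unitMap
  d := domMap hQ
  r := ranMap hQ
  m := multMap hQ hm

variable (Q) in
/-- `Q` is strongly multiplicative if it is multiplicative and the multiplication of `𝒞(Q)` is an
open locale map. -/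
def IsStronglyMultiplicative (hQ : Q.IsEhresmann) : Prop :=
  ∃ hm : Q.IsMultiplicative hQ, IsOpenMap (toLocalicCat hQ hm).m

end QuantalFrameData

/-! ### The Ehresmann quantal frame of a quantal localic category -/

/-- The data `𝒪(C)` of the Ehresmann quantal frame of a quantal localic category: the frame
`O(C₁)` with `a b = m_!(a ⊗ b)`, `e = u_!(1)`, `lam = u_! d_!` and `rho = u_! r_!`. -/
abbrev LocalicCatData.toQuantalFrame (C : LocalicCatData.{u}) : QuantalFrameData.{u} where
  carrier := C.Arr
  mul a b := LocaleMap.directImage C.m (FrameTensor.tmul C.d C.r a b)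
  e := LocaleMap.directImage C.u ⊤
  lam a := LocaleMap.directImage C.u (LocaleMap.directImage C.d a)
  rho a := LocaleMap.directImage C.u (LocaleMap.directImage C.r a)

end

/-!
The correspondence is between the frame of arrows of a localic category, with subsets of arrows
multiplied by `a b = m_!(a ⊗ b)`, and a quantal frame, whose structure maps have right adjoints that
are the inverse images `u^*`, `d^*`, `r^*`, `m^*`.

From `Q` to `𝒞(Q)`. In an Ehresmann quantal frame `d^*`, `r^*`, `u^*` automatically come from open
maps, with direct images `λ`, `ρ` and the inclusion of `e^↓`. If `m^*` preserves joins, the axioms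
of an internal category can be checked on pure tensors (`isLocalicCategory_toLocalicCat`), and since
left adjoints are unique, `𝒪(𝒞(Q)) = Q` (`toQuantalFrame_toLocalicCat`).

From `C` to `𝒪(C)`. Beck–Chevalley for pullbacks of open maps (`FrameTensor.tmul_le_snd_iff`,
`FrameTensor.mem_map_left_iff` and their mirror images) turns the category axioms into identities
for `m_!`. In particular `a u_!(l) = a ⊓ d^*(l)` and `u_!(l) a = r^*(l) ⊓ a`, so that restriction to
an open part of the objects is multiplication by a projection. Associativity of `m_!` is the one
identity for which `m` itself is taken to be open (`IsQuantal.isEhresmann`).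

Étaleness. Since `d^*(f) ⊓ c = c f` and `r^*(g) ⊓ c = g c`, an element `c` is a partial isometry
exactly when it witnesses that both `d` and `r` are local homeomorphisms; thus `d` and `r` are étale
if and only if the top element is a join of partial isometries.

Openness of `m`. The Frobenius condition for `m` says that everything below a product `x y` is a
join of products `p q` with `p ≤ x` and `q ≤ y` (`IsMulOpen`, `isOpenMap_m_iff`). If `x` and `y` are
partial isometries, then `p = x f` and `f q = y f'`, so `p q = x y f'`; hence this condition makes
`x y` a partial isometry. Conversely, if `Q` is étale and products of partial isometries are partial
isometries, then every element below such a product `x y` has the form `x (y f)`, which gives the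
Frobenius condition, and, with `x ⊗ y = x ⊗ y f` for `f ≥ λ(x y)`, also the preservation of joins by
`m^*`. The statements for `C` are reduced to those for `𝒪(C)`, and conversely.

Isomorphisms. Both constructions preserve isomorphisms, an internal functor being compatible with
direct images up to an inequality that is an equality for invertible functors. They reflect them
because `𝒪(𝒞(Q)) = Q` and `𝒞(𝒪(C)) ≃ C`, the latter given by `l ↦ u_!(l)` on objects.
-/

/-! ### Open maps and pushouts of frames -/

namespace LocaleMap

variable {L M : Type u} [Order.Frame L] [Order.Frame M]

theorem isSemiopen_of_gc {f : FrameHom M L} {l : L → M} (gc : GaloisConnection l f) :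
    IsSemiopen f := fun S => by rw [gc.u_sInf, sInf_image]

theorem directImage_eq_of_gc {f : FrameHom M L} {l : L → M} (gc : GaloisConnection l f) :
    directImage f = l :=
  funext fun _ => (directImage_gc (isSemiopen_of_gc gc)).l_unique gc fun _ => rfl

theorem isOpenMap_of_inf_le {f : FrameHom M L} (hf : IsSemiopen f)
    (h : ∀ (a : L) (b : M), directImage f a ⊓ b ≤ directImage f (a ⊓ f b)) : IsOpenMap f := by
  have gc := directImage_gc hf
  refine ⟨hf, fun a b => le_antisymm (le_inf (gc.monotone_l inf_le_left) ?_) (h a b)⟩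
  exact (gc _ _).2 inf_le_right

theorem directImage_id : directImage (FrameHom.id L) = id :=
  directImage_eq_of_gc (f := FrameHom.id L) (l := id) fun _ _ => Iff.rfl

theorem isOpenMap_id : IsOpenMap (FrameHom.id L) :=
  ⟨isSemiopen_of_gc (f := FrameHom.id L) (l := id) fun _ _ => Iff.rfl, fun a b => by
    rw [directImage_id]; rfl⟩

end LocaleMap

namespace FrameTensor

open LocaleMap

variable {L A B : Type u} [Order.Frame L] [Order.Frame A] [Order.Frame B]
variable {f : FrameHom L A} {g : FrameHom L B}

theorem eq_sSup_tmul (I : FrameTensor f g) :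
    I = sSup ((fun p : A × B => tmul f g p.1 p.2) '' I.carrier) := by
  apply le_antisymm
  · intro p hp
    exact tmul_le.1 (le_sSup (Set.mem_image_of_mem (fun p : A × B => tmul f g p.1 p.2) hp))
  · refine sSup_le ?_
    rintro _ ⟨p, hp, rfl⟩
    exact tmul_le.2 hp

theorem hom_le_iff {N : Type u} [Order.Frame N] (φ : FrameHom (FrameTensor f g) N)
    (I : FrameTensor f g) (n : N) :
    φ I ≤ n ↔ ∀ a b, (a, b) ∈ I.carrier → φ (tmul f g a b) ≤ n := by
  conv_lhs => rw [eq_sSup_tmul I, map_sSup]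
  simp only [sSup_le_iff, Set.forall_mem_image, Prod.forall]

theorem hom_ext_tmul {N : Type u} [Order.Frame N] {φ ψ : FrameHom (FrameTensor f g) N}
    (h : ∀ a b, φ (tmul f g a b) = ψ (tmul f g a b)) : φ = ψ :=
  hom_ext (DFunLike.ext _ _ fun a => h a ⊤) (DFunLike.ext _ _ fun b => h ⊤ b)

theorem tmul_sSup (a : A) (S : Set B) :
    tmul f g a (sSup S) = sSup ((fun b => tmul f g a b) '' S) := by
  apply le_antisymm
  · exact tmul_le.2 (sSup_right _ a S fun b hb => tmul_le.1 (le_sSup ⟨b, hb, rfl⟩))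
  · refine sSup_le ?_
    rintro _ ⟨b, hb, rfl⟩
    exact tmul_mono le_rfl (le_sSup hb)

theorem sSup_tmul (S : Set A) (b : B) :
    tmul f g (sSup S) b = sSup ((fun a => tmul f g a b) '' S) := by
  apply le_antisymm
  · exact tmul_le.2 (sSup_left _ S b fun a ha => tmul_le.1 (le_sSup ⟨a, ha, rfl⟩))
  · refine sSup_le ?_
    rintro _ ⟨a, ha, rfl⟩
    exact tmul_mono (le_sSup ha) le_rfl

/-- The Beck–Chevalley condition for the pullback of an open map `f`, with
`(π₂)_!(a ⊗ b) = g^* f_!(a) ⊓ b`. -/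
theorem tmul_le_snd_iff (hf : IsOpenMap f) {a : A} {b c : B} :
    tmul f g a b ≤ snd f g c ↔ g (directImage f a) ⊓ b ≤ c := by
  have gc := directImage_gc hf.1
  constructor
  · intro h
    -- the right adjoint of `a ⊗ b ↦ g^* f_!(a) ⊓ b`, evaluated at `c`
    let J : FrameTensor f g :=
      { carrier := {p | g (directImage f p.1) ⊓ p.2 ≤ c}
        lower := fun ha hb h =>
          (inf_le_inf (OrderHomClass.mono g (gc.monotone_l ha)) hb).trans h
        sSup_left := by
          intro S b h
          change g (directImage f (sSup S)) ⊓ b ≤ c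
          rw [← le_himp_iff, gc.l_sSup, map_iSup₂]
          exact iSup₂_le fun a ha => le_himp_iff.2 (h a ha)
        sSup_right := by
          intro a S h
          change g (directImage f a) ⊓ sSup S ≤ c
          rw [inf_sSup_eq]
          exact iSup₂_le h
        balanced := by
          intro a l b
          change g (directImage f (a ⊓ f l)) ⊓ b ≤ c ↔ g (directImage f a) ⊓ (g l ⊓ b) ≤ c
          rw [hf.2, map_inf, inf_assoc] }
    have hJ : snd f g c ≤ J := tmul_le.2 (inf_le_right : g (directImage f ⊤) ⊓ c ≤ c)
    exact tmul_le.1 (h.trans hJ)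
  · intro h
    calc tmul f g a b ≤ tmul f g (⊤ ⊓ f (directImage f a)) b := by
          rw [top_inf_eq]; exact tmul_mono (gc.le_u_l a) le_rfl
      _ = tmul f g ⊤ (g (directImage f a) ⊓ b) := tmul_balanced _ _ _
      _ ≤ snd f g c := tmul_mono le_rfl h

/-- The Beck–Chevalley condition for the pullback of an open map `g`, with
`(π₁)_!(a ⊗ b) = a ⊓ f^* g_!(b)`. -/
theorem tmul_le_fst_iff (hg : IsOpenMap g) {a c : A} {b : B} :
    tmul f g a b ≤ fst f g c ↔ a ⊓ f (directImage g b) ≤ c := by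
  have gc := directImage_gc hg.1
  constructor
  · intro h
    -- the right adjoint of `a ⊗ b ↦ a ⊓ f^* g_!(b)`, evaluated at `c`
    let J : FrameTensor f g :=
      { carrier := {p | p.1 ⊓ f (directImage g p.2) ≤ c}
        lower := fun ha hb h =>
          (inf_le_inf ha (OrderHomClass.mono f (gc.monotone_l hb))).trans h
        sSup_left := by
          intro S b h
          change sSup S ⊓ f (directImage g b) ≤ c
          rw [sSup_inf_eq]
          exact iSup₂_le h
        sSup_right := by
          intro a S h
          change a ⊓ f (directImage g (sSup S)) ≤ c
          rw [inf_comm, ← le_himp_iff, gc.l_sSup, map_iSup₂]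
          exact iSup₂_le fun b hb => le_himp_iff.2 (inf_comm a _ ▸ h b hb)
        balanced := by
          intro a l b
          change a ⊓ f l ⊓ f (directImage g b) ≤ c ↔ a ⊓ f (directImage g (g l ⊓ b)) ≤ c
          rw [inf_comm (g l), hg.2, map_inf, inf_assoc, inf_comm (f l)] }
    have hJ : fst f g c ≤ J := tmul_le.2 (inf_le_left : c ⊓ f (directImage g ⊤) ≤ c)
    exact tmul_le.1 (h.trans hJ)
  · intro h
    calc tmul f g a b ≤ tmul f g a (g (directImage g b) ⊓ ⊤) := by
          rw [inf_top_eq]; exact tmul_mono le_rfl (gc.le_u_l b)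
      _ = tmul f g (a ⊓ f (directImage g b)) ⊤ := (tmul_balanced _ _ _).symm
      _ ≤ fst f g c := tmul_mono h le_rfl

section map

variable {L' A' B' : Type u} [Order.Frame L'] [Order.Frame A'] [Order.Frame B']

theorem map_tmul {f' : FrameHom L' A'} {g' : FrameHom L' B'} (p : FrameHom A A')
    (q : FrameHom B B') (s : FrameHom L L') (hp : p.comp f = f'.comp s)
    (hq : q.comp g = g'.comp s) (a : A) (b : B) :
    map p q s hp hq (tmul f g a b) = tmul f' g' (p a) (q b) := by
  rw [map, lift_tmul]
  exact fst_inf_snd _ _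

theorem tmul_le_map {f' : FrameHom L' A'} {g' : FrameHom L' B'} {p : FrameHom A A'}
    {q : FrameHom B B'} {s : FrameHom L L'} {hp : p.comp f = f'.comp s} {hq : q.comp g = g'.comp s}
    {I : FrameTensor f g} {a' : A'} {b' : B'} {a : A} {b : B} (h : (a, b) ∈ I.carrier)
    (ha : a' ≤ p a) (hb : b' ≤ q b) : tmul f' g' a' b' ≤ map p q s hp hq I := by
  refine (tmul_mono ha hb).trans ?_
  rw [← map_tmul p q s hp hq]
  exact OrderHomClass.mono _ (tmul_le.2 h)

theorem map_le_iff {f' : FrameHom L' A'} {g' : FrameHom L' B'} {p : FrameHom A A'}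
    {q : FrameHom B B'} {s : FrameHom L L'} {hp : p.comp f = f'.comp s} {hq : q.comp g = g'.comp s}
    {I : FrameTensor f g} {J : FrameTensor f' g'} :
    map p q s hp hq I ≤ J ↔ ∀ a b, (a, b) ∈ I.carrier → tmul f' g' (p a) (q b) ≤ J := by
  rw [hom_le_iff]
  simp only [map_tmul]

theorem hom_map_le {f' : FrameHom L' A'} {g' : FrameHom L' B'} {p : FrameHom A A'}
    {q : FrameHom B B'} {s : FrameHom L L'} {hp : p.comp f = f'.comp s} {hq : q.comp g = g'.comp s}
    {N : Type u} [Order.Frame N] {φ : FrameHom (FrameTensor f' g') N} {I : FrameTensor f g} {n : N}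
    (h : ∀ a b, (a, b) ∈ I.carrier → φ (tmul f' g' (p a) (q b)) ≤ n) :
    φ (map p q s hp hq I) ≤ n := by
  refine (hom_le_iff (φ.comp (map p q s hp hq)) I n).2 fun a b hab => ?_
  rw [FrameHom.comp_apply, map_tmul]
  exact h a b hab

theorem tmul_le_of_left {f' : FrameHom L' (FrameTensor f g)} {g' : FrameHom L' B'}
    {I : FrameTensor f g} {b : B'} {K : FrameTensor f' g'}
    (h : ∀ x y, (x, y) ∈ I.carrier → tmul f' g' (tmul f g x y) b ≤ K) : tmul f' g' I b ≤ K := by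
  rw [eq_sSup_tmul I, sSup_tmul]
  refine sSup_le ?_
  rintro _ ⟨_, ⟨p, hp, rfl⟩, rfl⟩
  exact h _ _ hp

theorem hom_tmul_le_of_right {f' : FrameHom L' A'} {g' : FrameHom L' (FrameTensor f g)}
    {N : Type u} [Order.Frame N] {φ : FrameHom (FrameTensor f' g') N} {I : FrameTensor f g}
    {a : A'} {n : N} (h : ∀ x y, (x, y) ∈ I.carrier → φ (tmul f' g' a (tmul f g x y)) ≤ n) :
    φ (tmul f' g' a I) ≤ n := by
  rw [eq_sSup_tmul I, tmul_sSup, map_sSup]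
  refine sSup_le ?_
  rintro _ ⟨_, ⟨_, ⟨p, hp, rfl⟩, rfl⟩, rfl⟩
  exact h _ _ hp

/-- `(p × id)_!(x ⊗ y) = p_!(x) ⊗ y` for an open map `p` over the base. -/
theorem mem_map_left_iff {f' : FrameHom L A'} {p : FrameHom A A'} (ho : IsOpenMap p)
    (hp : p.comp f = f'.comp (FrameHom.id L))
    (hq : (FrameHom.id B).comp g = g.comp (FrameHom.id L)) {I : FrameTensor f g} {x : A'} {y : B} :
    (x, y) ∈ (map p (FrameHom.id B) (FrameHom.id L) hp hq I).carrier ↔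
      (directImage p x, y) ∈ I.carrier := by
  have gc := directImage_gc ho.1
  have e : ∀ l, f' l = p (f l) := fun l => (DFunLike.congr_fun hp l).symm
  constructor
  · intro h
    -- the right adjoint of `x ⊗ y ↦ p_!(x) ⊗ y`, evaluated at `I`
    let J : FrameTensor f' g :=
      { carrier := {z | (directImage p z.1, z.2) ∈ I.carrier}
        lower := fun ha hb h => I.lower (gc.monotone_l ha) hb h
        sSup_left := by
          intro S b h
          change (directImage p (sSup S), b) ∈ I.carrier
          rw [gc.l_sSup, ← sSup_image]
          refine I.sSup_left _ _ ?_
          rintro _ ⟨a, ha, rfl⟩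
          exact h a ha
        sSup_right := fun a S h => I.sSup_right _ S h
        balanced := by
          intro a l b
          change (directImage p (a ⊓ f' l), b) ∈ I.carrier ↔ _
          rw [e, ho.2]
          exact I.balanced _ l b }
    have hJ : map p (FrameHom.id B) (FrameHom.id L) hp hq I ≤ J := by
      rw [hom_le_iff]
      intro a b hab
      rw [map_tmul, tmul_le]
      exact I.lower (gc.l_u_le a) le_rfl hab
    exact hJ h
  · intro h
    rw [← tmul_le] at h ⊢
    calc tmul f' g x y ≤ tmul f' g (p (directImage p x)) y := tmul_mono (gc.le_u_l x) le_rfl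
      _ = map p (FrameHom.id B) (FrameHom.id L) hp hq (tmul f g (directImage p x) y) :=
          (map_tmul p (FrameHom.id B) _ hp hq _ _).symm
      _ ≤ _ := OrderHomClass.mono _ h

/-- `(id × q)_!(x ⊗ y) = x ⊗ q_!(y)` for an open map `q` over the base. -/
theorem mem_map_right_iff {g' : FrameHom L B'} {q : FrameHom B B'} (ho : IsOpenMap q)
    (hp : (FrameHom.id A).comp f = f.comp (FrameHom.id L))
    (hq : q.comp g = g'.comp (FrameHom.id L)) {I : FrameTensor f g} {x : A} {y : B'} :
    (x, y) ∈ (map (FrameHom.id A) q (FrameHom.id L) hp hq I).carrier ↔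
      (x, directImage q y) ∈ I.carrier := by
  have gc := directImage_gc ho.1
  have e : ∀ l, g' l = q (g l) := fun l => (DFunLike.congr_fun hq l).symm
  constructor
  · intro h
    -- the right adjoint of `x ⊗ y ↦ x ⊗ q_!(y)`, evaluated at `I`
    let J : FrameTensor f g' :=
      { carrier := {z | (z.1, directImage q z.2) ∈ I.carrier}
        lower := fun ha hb h => I.lower ha (gc.monotone_l hb) h
        sSup_left := fun S b h => I.sSup_left S _ h
        sSup_right := by
          intro a S h
          change (a, directImage q (sSup S)) ∈ I.carrier
          rw [gc.l_sSup, ← sSup_image]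
          refine I.sSup_right _ _ ?_
          rintro _ ⟨b, hb, rfl⟩
          exact h b hb
        balanced := by
          intro a l b
          change _ ↔ (a, directImage q (g' l ⊓ b)) ∈ I.carrier
          rw [e, inf_comm (q _), ho.2, inf_comm _ (g l)]
          exact I.balanced a l _ }
    have hJ : map (FrameHom.id A) q (FrameHom.id L) hp hq I ≤ J := by
      rw [hom_le_iff]
      intro a b hab
      rw [map_tmul, tmul_le]
      exact I.lower le_rfl (gc.l_u_le b) hab
    exact hJ h
  · intro h
    rw [← tmul_le] at h ⊢
    calc tmul f g' x y ≤ tmul f g' x (q (directImage q y)) := tmul_mono le_rfl (gc.le_u_l y)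
      _ = map (FrameHom.id A) q (FrameHom.id L) hp hq (tmul f g x (directImage q y)) :=
          (map_tmul (FrameHom.id A) q _ hp hq _ _).symm
      _ ≤ _ := OrderHomClass.mono _ h

end map

end FrameTensor

/-! ### Partial isometries and openness of the multiplication -/

namespace QuantalFrameData

open LocaleMap FrameTensor

variable {Q : QuantalFrameData.{u}}

/-- Every element below a product `x y` is a join of products `p q` with `p ≤ x` and `q ≤ y`.
This is the Frobenius condition for the multiplication, expressed without the tensor product. -/
def IsMulOpen (Q : QuantalFrameData.{u}) : Prop :=
  ∀ x y b : Q, b ≤ x * y → b ≤ sSup {c | ∃ p ≤ x, ∃ q ≤ y, c = p * q ∧ p * q ≤ b}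

theorem IsPartialIsometry.mono {a b : Q} (ha : Q.IsPartialIsometry a) (h : b ≤ a)
    (hQ : Q.IsEhresmann) : Q.IsPartialIsometry b := by
  intro c hc
  obtain ⟨f, hf, g, hg, h₁, h₂⟩ := ha c (hc.trans h)
  refine ⟨f, hf, g, hg, le_antisymm ?_ ?_, le_antisymm ?_ ?_⟩
  · rw [← hQ.inf_top_mul b hf]
    refine le_inf hc ?_
    rw [h₁]
    exact hQ.mul_mono le_top le_rfl
  · rw [h₁]
    exact hQ.mul_mono h le_rfl
  · rw [← hQ.mul_top_inf b hg]
    refine le_inf ?_ hc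
    rw [h₂]
    exact hQ.mul_mono le_rfl le_top
  · rw [h₂]
    exact hQ.mul_mono le_rfl h

/-- An étale `Q` is generated by its partial isometries, hence so is `Q ⊗ Q`. -/
theorem IsEtale.mem_of_forall (hQ : Q.IsEhresmann) (he : Q.IsEtale) {J : Tensor hQ} {x y : Q}
    (h : ∀ x' ≤ x, ∀ y' ≤ y, Q.IsPartialIsometry x' → Q.IsPartialIsometry y' →
      (x', y') ∈ J.carrier) : (x, y) ∈ J.carrier := by
  obtain ⟨T, hT, hT'⟩ := he
  have cover : ∀ z : Q, z = sSup ((fun t => z ⊓ t) '' T) := fun z => by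
    rw [sSup_image, ← inf_sSup_eq, hT', inf_top_eq]
  rw [cover x]
  refine J.sSup_left _ _ ?_
  rintro _ ⟨s, hs, rfl⟩
  rw [cover y]
  refine J.sSup_right _ _ ?_
  rintro _ ⟨t, ht, rfl⟩
  exact h _ inf_le_left _ inf_le_left ((hT s hs).mono inf_le_right hQ)
    ((hT t ht).mono inf_le_right hQ)

theorem IsEhresmann.mul_le_left (hQ : Q.IsEhresmann) (a : Q) {f : Q} (hf : f ≤ Q.e) :
    a * f ≤ a := by
  simpa only [hQ.mul_e] using hQ.mul_mono (le_refl a) hf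

theorem IsEhresmann.mul_le_right (hQ : Q.IsEhresmann) (a : Q) {f : Q} (hf : f ≤ Q.e) :
    f * a ≤ a := by
  simpa only [hQ.e_mul] using hQ.mul_mono hf (le_refl a)

/-- `x ⊗ y = x ⊗ y f` for every projection `f` above `λ(x y)`. -/
theorem IsEhresmann.tmul_le_tmul_mul (hQ : Q.IsEhresmann) (x y : Q) {f : Q}
    (h : Q.lam (x * y) ≤ f) :
    tmul (domMap hQ) (ranMap hQ) x y ≤ tmul (domMap hQ) (ranMap hQ) x (y * f) := by
  have e := tmul_balanced (f := domMap hQ) (g := ranMap hQ) x ⟨Q.lam x, hQ.lam_le x⟩ y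
  change tmul _ _ (x ⊓ ⊤ * Q.lam x) y = tmul _ _ x (Q.lam x * ⊤ ⊓ y) at e
  rw [hQ.inf_top_mul x (hQ.lam_le x), hQ.mul_top_inf y (hQ.lam_le x), hQ.mul_lam_self] at e
  rw [e]
  refine tmul_mono le_rfl ?_
  rw [← hQ.mul_lam_self (Q.lam x * y), ← hQ.lam_mul]
  exact hQ.mul_mono (hQ.mul_le_right y (hQ.lam_le x)) h

/-- `x ⊗ y = g x ⊗ y` for every projection `g` above `ρ(x y)`. -/
theorem IsEhresmann.tmul_le_mul_tmul (hQ : Q.IsEhresmann) (x y : Q) {g : Q}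
    (h : Q.rho (x * y) ≤ g) :
    tmul (domMap hQ) (ranMap hQ) x y ≤ tmul (domMap hQ) (ranMap hQ) (g * x) y := by
  have e := tmul_balanced (f := domMap hQ) (g := ranMap hQ) x ⟨Q.rho y, hQ.rho_le y⟩ y
  change tmul _ _ (x ⊓ ⊤ * Q.rho y) y = tmul _ _ x (Q.rho y * ⊤ ⊓ y) at e
  rw [hQ.inf_top_mul x (hQ.rho_le y), hQ.mul_top_inf y (hQ.rho_le y), hQ.rho_mul_self] at e
  rw [← e]
  refine tmul_mono ?_ le_rfl
  rw [← hQ.rho_mul_self (x * Q.rho y), ← hQ.rho_mul]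
  exact hQ.mul_mono h (hQ.mul_le_left x (hQ.rho_le y))

theorem IsEtale.isMultiplicative (hQ : Q.IsEhresmann) (he : Q.IsEtale) (hp : Q.PIClosed) :
    Q.IsMultiplicative hQ := by
  intro S
  apply le_antisymm
  · rintro ⟨x₀, y₀⟩ (h₀ : x₀ * y₀ ≤ sSup S)
    refine he.mem_of_forall hQ fun x hx y hy px py => ?_
    have hxy : x * y ≤ sSup S := (hQ.mul_mono hx hy).trans h₀
    -- the projections `f` for which `x y f` lies below a member of `S`
    set F : Set Q := {f | f ≤ Q.e ∧ ∃ s ∈ S, x * y * f ≤ s} with hF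
    have hFe : sSup F ≤ Q.e := sSup_le fun f hf => hf.1
    have hle : x * y ≤ ⊤ * sSup F := by
      calc x * y = x * y ⊓ sSup S := (inf_eq_left.2 hxy).symm
        _ ≤ ⊤ * sSup F := by
          rw [inf_sSup_eq]
          refine iSup₂_le fun s hs => ?_
          obtain ⟨f, hf, -, -, h₁, -⟩ := hp x y px py (x * y ⊓ s) inf_le_left
          rw [h₁]
          exact hQ.mul_mono le_top (le_sSup ⟨hf, s, hs, h₁ ▸ inf_le_right⟩)
    have ht := hQ.tmul_le_tmul_mul x y ((hQ.le_top_mul_iff hFe).1 hle)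
    refine tmul_le.1 (ht.trans (tmul_le.2 ?_))
    rw [hQ.mul_sSup]
    refine FrameTensor.sSup_right _ _ _ ?_
    rintro _ ⟨f, ⟨hf, s, hs, hfs⟩, rfl⟩
    have hm : (x, y * f) ∈ (comulMap hQ s).carrier := by
      change x * (y * f) ≤ s
      rwa [← hQ.mul_assoc]
    exact (le_sSup (Set.mem_image_of_mem _ hs) : comulMap hQ s ≤ _) hm
  · refine sSup_le ?_
    rintro _ ⟨s, hs, rfl⟩
    exact (mulMap_gc hQ).monotone_u (le_sSup hs)

theorem IsEtale.isMulOpen (hQ : Q.IsEhresmann) (he : Q.IsEtale) (hp : Q.PIClosed) :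
    Q.IsMulOpen := by
  intro x y b hb
  set z : Q := sSup {c | ∃ p ≤ x, ∃ q ≤ y, c = p * q ∧ p * q ≤ b} with hz
  have h : (x, y) ∈ (comulMap hQ (b ⇨ z)).carrier := by
    refine he.mem_of_forall hQ fun x' hx y' hy px py => ?_
    change x' * y' ≤ b ⇨ z
    rw [le_himp_iff]
    obtain ⟨f, hf, -, -, h₁, -⟩ := hp x' y' px py (x' * y' ⊓ b) inf_le_left
    rw [h₁]
    refine le_sSup ⟨x', hx, y' * f, (hQ.mul_le_left y' hf).trans hy, hQ.mul_assoc _ _ _, ?_⟩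
    rw [← hQ.mul_assoc, ← h₁]
    exact inf_le_right
  have h' : x * y ≤ b ⇨ z := h
  exact (le_inf hb le_rfl).trans (le_himp_iff.1 h')

/-- If `p ≤ x` and `q ≤ y` with `x`, `y` partial isometries, projections can be moved past `y`
to the right or past `x` to the left, so that `p q = x y f = g x y`. -/
theorem IsMulOpen.piClosed (hQ : Q.IsEhresmann) (ho : Q.IsMulOpen) : Q.PIClosed := by
  intro x y px py b hb
  set F : Set Q := {f | f ≤ Q.e ∧ x * y * f ≤ b} with hF
  set G : Set Q := {g | g ≤ Q.e ∧ g * (x * y) ≤ b} with hG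
  refine ⟨sSup F, sSup_le fun f hf => hf.1, sSup G, sSup_le fun g hg => hg.1,
    le_antisymm ((ho x y b hb).trans (sSup_le ?_)) ?_,
    le_antisymm ((ho x y b hb).trans (sSup_le ?_)) ?_⟩
  · rintro _ ⟨p, hp, q, hq, rfl, hpq⟩
    obtain ⟨f, hf, -, -, rfl, -⟩ := px p hp
    obtain ⟨f', hf', -, -, h₁, -⟩ := py (f * q) ((hQ.mul_le_right q hf).trans hq)
    rw [hQ.mul_assoc, h₁, ← hQ.mul_assoc] at hpq ⊢
    exact hQ.mul_mono le_rfl (le_sSup ⟨hf', hpq⟩)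
  · rw [hQ.mul_sSup]
    refine sSup_le ?_
    rintro _ ⟨f, hf, rfl⟩
    exact hf.2
  · rintro _ ⟨p, hp, q, hq, rfl, hpq⟩
    obtain ⟨-, -, g, hg, -, rfl⟩ := py q hq
    obtain ⟨-, -, g', hg', -, h₂⟩ := px (p * g) ((hQ.mul_le_left p hg).trans hp)
    rw [← hQ.mul_assoc, h₂, hQ.mul_assoc] at hpq ⊢
    exact hQ.mul_mono (le_sSup ⟨hg', hpq⟩) le_rfl
  · rw [hQ.sSup_mul]
    refine sSup_le ?_
    rintro _ ⟨g, hg, rfl⟩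
    exact hg.2

end QuantalFrameData

namespace LocalicCatData

open LocaleMap FrameTensor

variable {C : LocalicCatData.{u}}

theorem isOpenMap_m_iff (hm : IsSemiopen C.m) :
    IsOpenMap C.m ↔ C.toQuantalFrame.IsMulOpen := by
  have gc := directImage_gc hm
  constructor
  · intro ho x y b hb
    have h : directImage C.m (tmul C.d C.r x y ⊓ C.m b) = b :=
      (ho.2 _ _).trans (inf_eq_right.2 hb)
    conv_lhs => rw [← h]
    rw [gc, inf_comm, ← le_himp_iff]
    rintro ⟨p, q⟩ hpq
    rw [← tmul_le, le_himp_iff, tmul_inf]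
    rw [← gc]
    refine le_sSup ⟨p ⊓ x, inf_le_right, q ⊓ y, inf_le_right, rfl, ?_⟩
    exact (gc _ _).2 (tmul_le.2 ((C.m b).lower inf_le_left inf_le_left hpq))
  · intro ho
    refine isOpenMap_of_inf_le hm fun I b => ?_
    rw [← le_himp_iff, gc]
    rintro ⟨x, y⟩ hxy
    rw [← tmul_le, ← gc, le_himp_iff]
    refine (ho x y (directImage C.m (tmul C.d C.r x y) ⊓ b) inf_le_left).trans (sSup_le ?_)
    rintro _ ⟨p, hp, q, hq, rfl, hpq⟩
    refine gc.monotone_l (le_inf ?_ ?_)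
    · exact tmul_le.2 (I.lower hp hq hxy)
    · exact (gc _ _).1 (hpq.trans inf_le_right)

end LocalicCatData

/-! ### The quantal frame of a localic category -/

namespace LocalicCatData

open LocaleMap FrameTensor

variable (C : LocalicCatData.{u})

/-- The inverse of the associativity isomorphism `LocalicCatData.assoc`. -/
def assocInv : FrameHom C.TriplesL C.TriplesR :=
  lift (f := C.π₂.comp C.d) (g := C.r)
    (lift (f := C.d) (g := C.r) (fst C.d (C.π₁.comp C.r))
      ((snd C.d (C.π₁.comp C.r)).comp C.π₁) (by
        rw [fst_comp_eq_snd_comp, FrameHom.comp_assoc]))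
    ((snd C.d (C.π₁.comp C.r)).comp C.π₂) (by
      rw [← FrameHom.comp_assoc, lift_comp_snd, FrameHom.comp_assoc, FrameHom.comp_assoc,
        fst_comp_eq_snd_comp])

theorem assoc_tmul (a b c : C.Arr) :
    C.assoc (tmul C.d (C.π₁.comp C.r) a (tmul C.d C.r b c)) =
      tmul (C.π₂.comp C.d) C.r (tmul C.d C.r a b) c := by
  rw [assoc, lift_tmul, lastTwo, lift_tmul]
  change tmul _ _ (tmul _ _ a ⊤) ⊤ ⊓ (tmul _ _ (tmul _ _ ⊤ b) ⊤ ⊓ tmul _ _ ⊤ c) = _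
  rw [← inf_assoc, tmul_inf, tmul_inf, tmul_inf]
  simp

theorem assocInv_tmul (a b c : C.Arr) :
    C.assocInv (tmul (C.π₂.comp C.d) C.r (tmul C.d C.r a b) c) =
      tmul C.d (C.π₁.comp C.r) a (tmul C.d C.r b c) := by
  rw [assocInv, lift_tmul, lift_tmul]
  change (tmul _ _ a ⊤ ⊓ tmul _ _ ⊤ (tmul _ _ b ⊤)) ⊓ tmul _ _ ⊤ (tmul _ _ ⊤ c) = _
  rw [inf_assoc, tmul_inf, tmul_inf, tmul_inf]
  simp

theorem triplesR_hom_ext {N : Type u} [Order.Frame N] {φ ψ : FrameHom C.TriplesR N}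
    (h : ∀ a b c, φ (tmul C.d (C.π₁.comp C.r) a (tmul C.d C.r b c)) =
      ψ (tmul C.d (C.π₁.comp C.r) a (tmul C.d C.r b c))) : φ = ψ := by
  refine hom_ext (DFunLike.ext _ _ fun a => ?_) (hom_ext_tmul fun b c => h ⊤ b c)
  have := h a ⊤ ⊤
  rw [tmul_top_top] at this
  exact this

theorem assocInv_assoc (K : C.TriplesR) : C.assocInv (C.assoc K) = K := by
  have h : C.assocInv.comp C.assoc = FrameHom.id C.TriplesR := C.triplesR_hom_ext fun a b c => by
    change C.assocInv (C.assoc _) = _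
    rw [assoc_tmul, assocInv_tmul]
    rfl
  exact DFunLike.congr_fun h K

theorem tmul_tmul_le_assoc_iff (a b c : C.Arr) (K : C.TriplesR) :
    tmul (C.π₂.comp C.d) C.r (tmul C.d C.r a b) c ≤ C.assoc K ↔
      tmul C.d (C.π₁.comp C.r) a (tmul C.d C.r b c) ≤ K := by
  constructor
  · intro h
    have := OrderHomClass.mono C.assocInv h
    rwa [assocInv_tmul, assocInv_assoc] at this
  · intro h
    rw [← assoc_tmul]
    exact OrderHomClass.mono _ h

variable {C}

theorem IsEtale.isQuantal (hC : C.IsEtale) : C.IsQuantal :=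
  { hC.toIsLocalicCategory with
    d_open := hC.d_etale.1
    r_open := hC.r_etale.1
    u_open := hC.u_open
    m_semiopen := hC.m_open.1 }

namespace IsQuantal

theorem u_d_apply (hC : C.IsQuantal) (l : C.Obj) : C.u (C.d l) = l :=
  DFunLike.congr_fun hC.d_u l

theorem u_r_apply (hC : C.IsQuantal) (l : C.Obj) : C.u (C.r l) = l :=
  DFunLike.congr_fun hC.r_u l

theorem u_directImage_u (hC : C.IsQuantal) (l : C.Obj) : C.u (directImage C.u l) = l := by
  have gc := directImage_gc hC.u_open.1
  refine le_antisymm ?_ (gc.le_u_l l)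
  calc C.u (directImage C.u l) ≤ C.u (C.d l) :=
        OrderHomClass.mono _ ((gc _ _).2 (hC.u_d_apply l).ge)
    _ = l := hC.u_d_apply l

theorem directImage_u_u (hC : C.IsQuantal) {a : C.Arr} (h : a ≤ directImage C.u ⊤) :
    directImage C.u (C.u a) = a := by
  have := hC.u_open.2 ⊤ a
  rwa [top_inf_eq, inf_eq_right.2 h] at this

theorem directImage_d_directImage_u (hC : C.IsQuantal) (l : C.Obj) :
    directImage C.d (directImage C.u l) = l := by
  refine eq_of_forall_ge_iff fun n => ?_
  rw [directImage_gc hC.d_open.1, directImage_gc hC.u_open.1, hC.u_d_apply]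

theorem directImage_r_directImage_u (hC : C.IsQuantal) (l : C.Obj) :
    directImage C.r (directImage C.u l) = l := by
  refine eq_of_forall_ge_iff fun n => ?_
  rw [directImage_gc hC.r_open.1, directImage_gc hC.u_open.1, hC.u_r_apply]

/-- Multiplying by a set of identities on the right restricts the domain. -/
theorem mul_directImage_u (hC : C.IsQuantal) (x : C.Arr) (l : C.Obj) :
    directImage C.m (tmul C.d C.r x (directImage C.u l)) = x ⊓ C.d l := by
  refine eq_of_forall_ge_iff fun n => ?_
  have e := DFunLike.congr_fun hC.unit_right n
  have h : (x, l) ∈ (fst C.d (FrameHom.id C.Obj) n).carrier ↔ x ⊓ C.d l ≤ n := by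
    rw [← tmul_le, tmul_le_fst_iff isOpenMap_id, directImage_id]
    rfl
  rw [directImage_gc hC.m_semiopen, tmul_le, ← h, ← e]
  exact (mem_map_right_iff hC.u_open (by rw [FrameHom.comp_id, FrameHom.id_comp])
    (by rw [hC.r_u, FrameHom.comp_id])).symm

/-- Multiplying by a set of identities on the left restricts the codomain. -/
theorem directImage_u_mul (hC : C.IsQuantal) (x : C.Arr) (l : C.Obj) :
    directImage C.m (tmul C.d C.r (directImage C.u l) x) = C.r l ⊓ x := by
  refine eq_of_forall_ge_iff fun n => ?_
  have e := DFunLike.congr_fun hC.unit_left n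
  have h : (l, x) ∈ (snd (FrameHom.id C.Obj) C.r n).carrier ↔ C.r l ⊓ x ≤ n := by
    rw [← tmul_le, tmul_le_snd_iff isOpenMap_id, directImage_id]
    rfl
  rw [directImage_gc hC.m_semiopen, tmul_le, ← h, ← e]
  exact (mem_map_left_iff hC.u_open (by rw [hC.d_u, FrameHom.comp_id])
    (by rw [FrameHom.comp_id, FrameHom.id_comp])).symm

theorem directImage_d_m (hC : C.IsQuantal) (a b : C.Arr) :
    directImage C.d (directImage C.m (tmul C.d C.r a b)) =
      directImage C.d (C.r (directImage C.d a) ⊓ b) := by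
  refine eq_of_forall_ge_iff fun n => ?_
  rw [directImage_gc hC.d_open.1, directImage_gc hC.m_semiopen, directImage_gc hC.d_open.1,
    ← tmul_le_snd_iff hC.d_open]
  exact iff_of_eq (congrArg _ (DFunLike.congr_fun hC.d_m n))

theorem directImage_r_m (hC : C.IsQuantal) (a b : C.Arr) :
    directImage C.r (directImage C.m (tmul C.d C.r a b)) =
      directImage C.r (a ⊓ C.d (directImage C.r b)) := by
  refine eq_of_forall_ge_iff fun n => ?_
  rw [directImage_gc hC.r_open.1, directImage_gc hC.m_semiopen, directImage_gc hC.r_open.1,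
    ← tmul_le_fst_iff hC.r_open]
  exact iff_of_eq (congrArg _ (DFunLike.congr_fun hC.r_m n))

/-- The multiplication of subsets of arrows is associative as soon as the multiplication map is
open: the two sides are the direct images of `(a ⊗ b) ⊗ c` and `a ⊗ (b ⊗ c)` under the two
composites in the associativity square, computed by Beck–Chevalley. -/
theorem directImage_m_assoc (hC : C.IsQuantal) (hm : IsOpenMap C.m) (a b c : C.Arr) :
    directImage C.m (tmul C.d C.r (directImage C.m (tmul C.d C.r a b)) c) =
      directImage C.m (tmul C.d C.r a (directImage C.m (tmul C.d C.r b c))) := by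
  refine eq_of_forall_ge_iff fun n => ?_
  have e := DFunLike.congr_fun hC.mul_assoc n
  rw [directImage_gc hm.1, directImage_gc hm.1, tmul_le, tmul_le,
    ← mem_map_left_iff hm (by rw [hC.d_m, FrameHom.comp_id])
      (by rw [FrameHom.comp_id, FrameHom.id_comp]),
    ← mem_map_right_iff hm (by rw [FrameHom.comp_id, FrameHom.id_comp])
      (by rw [hC.r_m, FrameHom.comp_id]), ← tmul_le, ← tmul_le, ← tmul_tmul_le_assoc_iff]
  exact iff_of_eq (congrArg _ e)

theorem isEhresmann (hC : C.IsQuantal) (hm : IsOpenMap C.m) : C.toQuantalFrame.IsEhresmann where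
  mul_assoc := hC.directImage_m_assoc hm
  e_mul a := (hC.directImage_u_mul a ⊤).trans (by rw [map_top, top_inf_eq])
  mul_e a := (hC.mul_directImage_u a ⊤).trans (by rw [map_top, inf_top_eq])
  mul_sSup a S := by
    change directImage C.m (tmul C.d C.r a (sSup S)) = _
    rw [tmul_sSup, (directImage_gc hm.1).l_sSup, iSup_image, sSup_image]
    rfl
  sSup_mul S b := by
    change directImage C.m (tmul C.d C.r (sSup S) b) = _
    rw [sSup_tmul, (directImage_gc hm.1).l_sSup, iSup_image, sSup_image]
    rfl
  lam_le a := (directImage_gc hC.u_open.1).monotone_l le_top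
  rho_le a := (directImage_gc hC.u_open.1).monotone_l le_top
  lam_sSup S := by
    change directImage C.u (directImage C.d (sSup S)) = _
    rw [(directImage_gc hC.d_open.1).l_sSup, sSup_image]
    simp only [(directImage_gc hC.u_open.1).l_iSup]
  rho_sSup S := by
    change directImage C.u (directImage C.r (sSup S)) = _
    rw [(directImage_gc hC.r_open.1).l_sSup, sSup_image]
    simp only [(directImage_gc hC.u_open.1).l_iSup]
  lam_proj a ha := by
    change directImage C.u (directImage C.d a) = a
    rw [← hC.directImage_u_u ha, hC.directImage_d_directImage_u]
  rho_proj a ha := by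
    change directImage C.u (directImage C.r a) = a
    rw [← hC.directImage_u_u ha, hC.directImage_r_directImage_u]
  rho_mul_self a := (hC.directImage_u_mul a _).trans
    (inf_eq_right.2 ((directImage_gc hC.r_open.1).le_u_l a))
  mul_lam_self a := (hC.mul_directImage_u a _).trans
    (inf_eq_left.2 ((directImage_gc hC.d_open.1).le_u_l a))
  lam_mul a b := by
    refine congrArg (directImage C.u) ((hC.directImage_d_m a b).trans ?_)
    rw [← hC.directImage_u_mul]
    rfl
  rho_mul a b := by
    refine congrArg (directImage C.u) ((hC.directImage_r_m a b).trans ?_)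
    rw [← hC.mul_directImage_u]
    rfl

end IsQuantal

/-! ### Local homeomorphisms and partial isometries -/

/-- If `d` is injective on the members of a cover `S`, and `r` on those of a cover `T`, then the
meets `s ⊓ t` with `s ∈ S` and `t ∈ T` are partial isometries. -/
theorem IsEtale.toQuantalFrame_isEtale (hC : C.IsEtale) : C.toQuantalFrame.IsEtale := by
  have hq := hC.isQuantal
  have gcu := directImage_gc hq.u_open.1
  obtain ⟨-, S, hS, hS'⟩ := hC.d_etale
  obtain ⟨-, T, hT, hT'⟩ := hC.r_etale
  refine ⟨{c | ∃ s ∈ S, ∃ t ∈ T, c = s ⊓ t}, ?_, ?_⟩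
  · rintro _ ⟨s, hs, t, ht, rfl⟩ b hb
    obtain ⟨x, rfl⟩ := hS' s hs b (hb.trans inf_le_left)
    obtain ⟨y, hy⟩ := hT' t ht _ (hb.trans inf_le_right)
    refine ⟨directImage C.u x, gcu.monotone_l le_top, directImage C.u y, gcu.monotone_l le_top,
      ?_, ?_⟩
    · refine Eq.trans ?_ (hq.mul_directImage_u _ _).symm
      refine le_antisymm (le_inf hb inf_le_left) ?_
      exact le_inf inf_le_right (inf_le_left.trans inf_le_left)
    · refine Eq.trans ?_ (hq.directImage_u_mul _ _).symm
      refine le_antisymm (le_inf (hy ▸ inf_le_left) hb) ?_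
      calc C.r y ⊓ (s ⊓ t) ≤ C.r y ⊓ t := inf_le_inf_left _ inf_le_right
        _ = C.d x ⊓ s := hy
  · have h : (⊤ : C.Arr) = sSup S ⊓ sSup T := by rw [hS, hT, inf_top_eq]
    refine top_le_iff.1 (h.le.trans ?_)
    rw [sSup_inf_sSup]
    exact iSup₂_le fun p hp => le_sSup ⟨p.1, hp.1, p.2, hp.2, rfl⟩

theorem IsQuantal.isEtaleMap_d (hC : C.IsQuantal) (he : C.toQuantalFrame.IsEtale) :
    IsEtaleMap C.d := by
  obtain ⟨S, hS, hS'⟩ := he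
  refine ⟨hC.d_open, S, hS', fun c hc a ha => ?_⟩
  obtain ⟨f, hf, -, -, h, -⟩ := hS c hc a ha
  refine ⟨C.u f, ?_⟩
  rw [inf_comm, ← hC.mul_directImage_u, hC.directImage_u_u hf]
  exact h.symm

theorem IsQuantal.isEtaleMap_r (hC : C.IsQuantal) (he : C.toQuantalFrame.IsEtale) :
    IsEtaleMap C.r := by
  obtain ⟨S, hS, hS'⟩ := he
  refine ⟨hC.r_open, S, hS', fun c hc a ha => ?_⟩
  obtain ⟨-, -, g, hg, -, h⟩ := hS c hc a ha
  refine ⟨C.u g, ?_⟩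
  rw [← hC.directImage_u_mul, hC.directImage_u_u hg]
  exact h.symm

theorem IsEtale.toQuantalFrame_isRestriction (hC : C.IsEtale) : C.toQuantalFrame.IsRestriction :=
  have hE := hC.isQuantal.isEhresmann hC.m_open
  { hE with
    etale := hC.toQuantalFrame_isEtale
    pi_closed := ((isOpenMap_m_iff hC.m_open.1).1 hC.m_open).piClosed hE }

theorem IsQuantal.isEtale_iff (hC : C.IsQuantal) : C.IsEtale ↔ C.toQuantalFrame.IsRestriction :=
  ⟨IsEtale.toQuantalFrame_isRestriction, fun h =>
    { hC.toIsLocalicCategory with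
      u_open := hC.u_open
      m_open := (isOpenMap_m_iff hC.m_semiopen).2 (h.etale.isMulOpen h.toIsEhresmann h.pi_closed)
      d_etale := hC.isEtaleMap_d h.etale
      r_etale := hC.isEtaleMap_r h.etale }⟩

end LocalicCatData

/-! ### The localic category of a multiplicative Ehresmann quantal frame -/

namespace QuantalFrameData

open LocaleMap FrameTensor

variable {Q : QuantalFrameData.{u}}

theorem unitMap_gc : GaloisConnection (fun f : Q.Proj => (f : Q)) (unitMap Q) := fun f _ =>
  ⟨fun h => le_inf h f.2, fun h => le_trans (show (f : Q) ≤ _ from h) inf_le_left⟩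

theorem domMap_gc (hQ : Q.IsEhresmann) :
    GaloisConnection (fun a : Q => (⟨Q.lam a, hQ.lam_le a⟩ : Q.Proj)) (domMap hQ) :=
  fun _ f => (hQ.le_top_mul_iff f.2).symm

theorem ranMap_gc (hQ : Q.IsEhresmann) :
    GaloisConnection (fun a : Q => (⟨Q.rho a, hQ.rho_le a⟩ : Q.Proj)) (ranMap hQ) :=
  fun _ f => (hQ.le_mul_top_iff f.2).symm

theorem directImage_multMap (hQ : Q.IsEhresmann) (hm : Q.IsMultiplicative hQ) :
    directImage (multMap hQ hm) = mulMap hQ :=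
  directImage_eq_of_gc (mulMap_gc hQ)

/-- `𝒪(𝒞(Q)) = Q`: the direct images occurring in `𝒪(𝒞(Q))` are the left adjoints of
`u^*`, `d^*`, `r^*` and `m^*`, which are the structure maps of `Q`. -/
theorem toQuantalFrame_toLocalicCat (hQ : Q.IsEhresmann) (hm : Q.IsMultiplicative hQ) :
    (toLocalicCat hQ hm).toQuantalFrame = Q := by
  have ext : ∀ {mul e lam rho}, mul = Q.mul → e = Q.e → lam = Q.lam → rho = Q.rho →
      ({ carrier := Q.carrier, frame := Q.frame, mul := mul, e := e, lam := lam, rho := rho } :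
        QuantalFrameData.{u}) = Q := by
    rintro _ _ _ _ rfl rfl rfl rfl
    rfl
  have hu := directImage_eq_of_gc (unitMap_gc (Q := Q))
  refine ext ?_ ?_ ?_ ?_
  · funext a b
    change directImage (multMap hQ hm) _ = _
    rw [directImage_multMap, mulMap_tmul]
    rfl
  · change directImage (unitMap Q) ⊤ = _
    rw [hu]
    rfl
  · funext a
    change directImage (unitMap Q) (directImage (domMap hQ) a) = _
    rw [hu, directImage_eq_of_gc (domMap_gc hQ)]
  · funext a
    change directImage (unitMap Q) (directImage (ranMap hQ) a) = _
    rw [hu, directImage_eq_of_gc (ranMap_gc hQ)]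

theorem isOpenMap_unitMap : IsOpenMap (unitMap Q) := by
  refine isOpenMap_of_inf_le (isSemiopen_of_gc unitMap_gc) fun f b => ?_
  rw [directImage_eq_of_gc unitMap_gc]
  exact le_inf inf_le_left (le_inf inf_le_right (inf_le_left.trans f.2))

theorem IsEhresmann.mul_self_of_le (hQ : Q.IsEhresmann) {f : Q} (hf : f ≤ Q.e) : f * f = f := by
  simpa only [hQ.lam_proj f hf] using hQ.mul_lam_self f

theorem isOpenMap_domMap (hQ : Q.IsEhresmann) : IsOpenMap (domMap hQ) := by
  refine isOpenMap_of_inf_le (isSemiopen_of_gc (domMap_gc hQ)) fun a f => ?_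
  rw [directImage_eq_of_gc (domMap_gc hQ)]
  change Q.lam a ⊓ (f : Q) ≤ Q.lam (a ⊓ ⊤ * (f : Q))
  rw [hQ.inf_top_mul a f.2, hQ.lam_mul, hQ.lam_proj _ ((hQ.mul_le_left _ f.2).trans (hQ.lam_le a)),
    ← hQ.mul_self_of_le (f := Q.lam a ⊓ f) (inf_le_right.trans f.2)]
  exact hQ.mul_mono inf_le_left inf_le_right

theorem isOpenMap_ranMap (hQ : Q.IsEhresmann) : IsOpenMap (ranMap hQ) := by
  refine isOpenMap_of_inf_le (isSemiopen_of_gc (ranMap_gc hQ)) fun a f => ?_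
  rw [directImage_eq_of_gc (ranMap_gc hQ)]
  change Q.rho a ⊓ (f : Q) ≤ Q.rho (a ⊓ (f : Q) * ⊤)
  rw [inf_comm a, hQ.mul_top_inf a f.2, hQ.rho_mul,
    hQ.rho_proj _ ((hQ.mul_le_right _ f.2).trans (hQ.rho_le a)),
    ← hQ.mul_self_of_le (f := Q.rho a ⊓ f) (inf_le_right.trans f.2)]
  exact hQ.mul_mono inf_le_right inf_le_left

theorem multMap_ranMap (hQ : Q.IsEhresmann) (hm : Q.IsMultiplicative hQ) (f : Q.Proj) :
    multMap hQ hm (ranMap hQ f) = fst (domMap hQ) (ranMap hQ) (ranMap hQ f) := by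
  apply le_antisymm
  · rintro ⟨x, y⟩ (h : x * y ≤ (f : Q) * ⊤)
    have ht := hQ.tmul_le_mul_tmul x y ((hQ.le_mul_top_iff f.2).1 h)
    exact tmul_le.1 (ht.trans (tmul_mono (hQ.mul_mono le_rfl le_top) le_top))
  · refine tmul_le.2 ?_
    change (f : Q) * ⊤ * ⊤ ≤ (f : Q) * ⊤
    rw [hQ.mul_assoc]
    exact hQ.mul_mono le_rfl le_top

theorem multMap_domMap (hQ : Q.IsEhresmann) (hm : Q.IsMultiplicative hQ) (f : Q.Proj) :
    multMap hQ hm (domMap hQ f) = snd (domMap hQ) (ranMap hQ) (domMap hQ f) := by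
  apply le_antisymm
  · rintro ⟨x, y⟩ (h : x * y ≤ ⊤ * (f : Q))
    have ht := hQ.tmul_le_tmul_mul x y ((hQ.le_top_mul_iff f.2).1 h)
    exact tmul_le.1 (ht.trans (tmul_mono le_top (hQ.mul_mono le_top le_rfl)))
  · refine tmul_le.2 ?_
    change ⊤ * (⊤ * (f : Q)) ≤ ⊤ * (f : Q)
    rw [← hQ.mul_assoc]
    exact hQ.mul_mono le_top le_rfl

theorem mem_multMap {hQ : Q.IsEhresmann} {hm : Q.IsMultiplicative hQ} {x y a : Q} :
    (x, y) ∈ (multMap hQ hm a).carrier ↔ x * y ≤ a := Iff.rfl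

theorem unitMap_domMap (hQ : Q.IsEhresmann) (f : Q.Proj) : unitMap Q (domMap hQ f) = f := by
  apply Subtype.ext
  change ⊤ * (f : Q) ⊓ Q.e = f
  rw [inf_comm, hQ.inf_top_mul _ f.2, hQ.e_mul]

theorem unitMap_ranMap (hQ : Q.IsEhresmann) (f : Q.Proj) : unitMap Q (ranMap hQ f) = f := by
  apply Subtype.ext
  change (f : Q) * ⊤ ⊓ Q.e = f
  rw [hQ.mul_top_inf _ f.2, hQ.mul_e]

theorem isLocalicCategory_toLocalicCat (hQ : Q.IsEhresmann) (hm : Q.IsMultiplicative hQ) :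
    (toLocalicCat hQ hm).IsLocalicCategory where
  d_u := DFunLike.ext _ _ (unitMap_domMap hQ)
  r_u := DFunLike.ext _ _ (unitMap_ranMap hQ)
  r_m := DFunLike.ext _ _ (multMap_ranMap hQ hm)
  d_m := DFunLike.ext _ _ (multMap_domMap hQ hm)
  unit_left := by
    refine DFunLike.ext _ _ fun a => ?_
    rw [FrameHom.comp_apply]
    refine le_antisymm (map_le_iff.2 fun x y hxy => ?_) ?_
    · rw [← top_inf_eq (Q.unitMap x)]
      refine (tmul_balanced (f := FrameHom.id Q.Proj) (g := ranMap hQ) ⊤ (unitMap Q x) y).le.trans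
        (tmul_mono le_rfl ?_)
      change (x ⊓ Q.e) * ⊤ ⊓ y ≤ a
      rw [hQ.mul_top_inf _ inf_le_right]
      exact (hQ.mul_mono inf_le_left le_rfl).trans hxy
    · exact tmul_le_map (a := Q.e) (b := a) (mem_multMap.2 (hQ.e_mul a).le)
        (le_inf le_rfl le_rfl) le_rfl
  unit_right := by
    refine DFunLike.ext _ _ fun a => ?_
    rw [FrameHom.comp_apply]
    refine le_antisymm (map_le_iff.2 fun x y hxy => ?_) ?_
    · rw [← inf_top_eq (Q.unitMap y)]
      refine (tmul_balanced (f := domMap hQ) (g := FrameHom.id Q.Proj) x (unitMap Q y) ⊤).ge.trans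
        (tmul_mono ?_ le_rfl)
      change x ⊓ ⊤ * (y ⊓ Q.e) ≤ a
      rw [hQ.inf_top_mul _ inf_le_right]
      exact (hQ.mul_mono le_rfl inf_le_left).trans hxy
    · exact tmul_le_map (a := a) (b := Q.e) (mem_multMap.2 (hQ.mul_e a).le)
        le_rfl (le_inf le_rfl le_rfl)
  mul_assoc := by
    -- both sides are the join of all `(x ⊗ y) ⊗ z` with `x y z ≤ a`
    refine DFunLike.ext _ _ fun a => ?_
    rw [FrameHom.comp_apply, FrameHom.comp_apply, FrameHom.comp_apply]
    refine le_antisymm (map_le_iff.2 fun x y hxy => ?_) ?_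
    · refine tmul_le_of_left fun z w hzw => ?_
      refine (LocalicCatData.tmul_tmul_le_assoc_iff _ _ _ _ _).2 ?_
      refine tmul_le_map (a := z) (b := w * y) (mem_multMap.2 ?_) le_rfl
        (tmul_le.2 (mem_multMap.2 (le_refl (w * y))))
      rw [← hQ.mul_assoc]
      exact (hQ.mul_mono hzw le_rfl).trans hxy
    · refine hom_map_le fun x y hxy => hom_tmul_le_of_right fun z w hzw => ?_
      rw [LocalicCatData.assoc_tmul]
      refine tmul_le_map (a := x * z) (b := w) (mem_multMap.2 ?_)
        (tmul_le.2 (mem_multMap.2 (le_refl (x * z)))) le_rfl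
      rw [hQ.mul_assoc]
      exact (hQ.mul_mono le_rfl hzw).trans hxy

theorem isQuantal_toLocalicCat (hQ : Q.IsEhresmann) (hm : Q.IsMultiplicative hQ) :
    (toLocalicCat hQ hm).IsQuantal :=
  { isLocalicCategory_toLocalicCat hQ hm with
    d_open := isOpenMap_domMap hQ
    r_open := isOpenMap_ranMap hQ
    u_open := isOpenMap_unitMap
    m_semiopen := isSemiopen_of_gc (mulMap_gc hQ) }

theorem isStronglyMultiplicative_iff (hQ : Q.IsEhresmann) (he : Q.IsEtale) :
    Q.PIClosed ↔ Q.IsStronglyMultiplicative hQ := by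
  have key : ∀ hm : Q.IsMultiplicative hQ,
      IsOpenMap (toLocalicCat hQ hm).m ↔ Q.IsMulOpen := fun hm => by
    rw [LocalicCatData.isOpenMap_m_iff (isQuantal_toLocalicCat hQ hm).m_semiopen,
      toQuantalFrame_toLocalicCat]
  constructor
  · intro hp
    have hm := he.isMultiplicative hQ hp
    exact ⟨hm, (key hm).2 (he.isMulOpen hQ hp)⟩
  · rintro ⟨hm, ho⟩
    exact ((key hm).1 ho).piClosed hQ

theorem isRestriction_iff (hQ : Q.IsEhresmann) :
    Q.IsRestriction ↔ ∃ hm : Q.IsMultiplicative hQ, (toLocalicCat hQ hm).IsEtale := by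
  have key : ∀ hm : Q.IsMultiplicative hQ,
      (toLocalicCat hQ hm).IsEtale ↔ Q.IsRestriction := fun hm => by
    rw [(isQuantal_toLocalicCat hQ hm).isEtale_iff, toQuantalFrame_toLocalicCat]
  constructor
  · intro h
    have hm := h.etale.isMultiplicative hQ h.pi_closed
    exact ⟨hm, (key hm).2 h⟩
  · rintro ⟨hm, h⟩
    exact (key hm).1 h

end QuantalFrameData

/-! ### Isomorphisms -/

namespace LocalicCatData

open LocaleMap FrameTensor

variable {C D E : LocalicCatData.{u}}

/-- Composition of internal functors. -/
def Hom.trans (F : Hom C D) (G : Hom D E) : Hom C E where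
  f₁ := F.f₁.comp G.f₁
  f₀ := F.f₀.comp G.f₀
  comm_d := by
    rw [FrameHom.comp_assoc, G.comm_d, ← FrameHom.comp_assoc, F.comm_d, FrameHom.comp_assoc]
  comm_r := by
    rw [FrameHom.comp_assoc, G.comm_r, ← FrameHom.comp_assoc, F.comm_r, FrameHom.comp_assoc]
  comm_u := by
    rw [FrameHom.comp_assoc, G.comm_u, ← FrameHom.comp_assoc, F.comm_u, FrameHom.comp_assoc]
  comm_m := by
    refine Eq.trans (congrArg (fun φ => FrameHom.comp φ E.m)
      (a₂ := (map F.f₁ F.f₁ F.f₀ F.comm_d F.comm_r).comp (map G.f₁ G.f₁ G.f₀ G.comm_d G.comm_r))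
      (hom_ext_tmul fun a b => ?_)) ?_
    · rw [FrameHom.comp_apply, map_tmul, map_tmul, map_tmul]
      rfl
    · rw [FrameHom.comp_assoc, G.comm_m, ← FrameHom.comp_assoc, F.comm_m, FrameHom.comp_assoc]

theorem Isomorphic.symm : C.Isomorphic D → D.Isomorphic C :=
  fun ⟨F, G, h₁, h₂, h₃, h₄⟩ => ⟨G, F, h₂, h₁, h₄, h₃⟩

theorem Isomorphic.trans : C.Isomorphic D → D.Isomorphic E → C.Isomorphic E := by
  have key : ∀ {A B C : Type u} [Order.Frame A] [Order.Frame B] [Order.Frame C]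
      {a : FrameHom A B} {b : FrameHom B A} {c : FrameHom B C} {d : FrameHom C B},
      a.comp b = FrameHom.id B → c.comp d = FrameHom.id C →
      (c.comp a).comp (b.comp d) = FrameHom.id C := by
    intro A B C _ _ _ a b c d h₁ h₂
    rw [FrameHom.comp_assoc, ← FrameHom.comp_assoc a, h₁, FrameHom.id_comp, h₂]
  rintro ⟨F, G, h₁, h₂, h₃, h₄⟩ ⟨F', G', k₁, k₂, k₃, k₄⟩
  exact ⟨F.trans F', G'.trans G, key k₁ h₁, key h₂ k₂, key k₃ h₃, key h₄ k₄⟩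

/-- An order isomorphism of frames as a frame homomorphism. -/
def frameHomOfOrderIso {A B : Type u} [Order.Frame A] [Order.Frame B] (φ : A ≃o B) :
    FrameHom A B where
  toFun := φ
  map_inf' := φ.map_inf
  map_top' := φ.map_top
  map_sSup' S := by rw [φ.map_sSup, sSup_image]

/-- The internal functor `C → D` given by order isomorphisms that respect the structure maps. -/
def Hom.ofOrderIso (φ : D.Arr ≃o C.Arr) (ψ : D.Obj ≃o C.Obj) (hd : ∀ l, φ (D.d l) = C.d (ψ l))
    (hr : ∀ l, φ (D.r l) = C.r (ψ l)) (hu : ∀ a, ψ (D.u a) = C.u (φ a))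
    (hm : ∀ x y a, (x, y) ∈ (D.m a).carrier ↔ (φ x, φ y) ∈ (C.m (φ a)).carrier) : Hom C D where
  f₁ := frameHomOfOrderIso φ
  f₀ := frameHomOfOrderIso ψ
  comm_d := DFunLike.ext _ _ hd
  comm_r := DFunLike.ext _ _ hr
  comm_u := DFunLike.ext _ _ hu
  comm_m := DFunLike.ext _ _ fun a => by
    rw [FrameHom.comp_apply, FrameHom.comp_apply]
    refine le_antisymm (map_le_iff.2 fun x y hxy => tmul_le.2 ((hm x y a).1 hxy)) ?_
    rintro ⟨x, y⟩ hxy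
    obtain ⟨x, rfl⟩ := φ.surjective x
    obtain ⟨y, rfl⟩ := φ.surjective y
    exact tmul_le.1 (tmul_le_map ((hm x y a).2 hxy) le_rfl le_rfl)

theorem isomorphic_of_orderIso (φ : D.Arr ≃o C.Arr) (ψ : D.Obj ≃o C.Obj)
    (hd : ∀ l, φ (D.d l) = C.d (ψ l)) (hr : ∀ l, φ (D.r l) = C.r (ψ l))
    (hu : ∀ a, ψ (D.u a) = C.u (φ a))
    (hm : ∀ x y a, (x, y) ∈ (D.m a).carrier ↔ (φ x, φ y) ∈ (C.m (φ a)).carrier) :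
    C.Isomorphic D := by
  refine ⟨Hom.ofOrderIso φ ψ hd hr hu hm,
    Hom.ofOrderIso φ.symm ψ.symm (fun l => ?_) (fun l => ?_) (fun a => ?_) (fun x y a => ?_),
    DFunLike.ext _ _ φ.apply_symm_apply, DFunLike.ext _ _ φ.symm_apply_apply,
    DFunLike.ext _ _ ψ.apply_symm_apply, DFunLike.ext _ _ ψ.symm_apply_apply⟩
  · rw [φ.symm_apply_eq, hd, ψ.apply_symm_apply]
  · rw [φ.symm_apply_eq, hr, ψ.apply_symm_apply]
  · rw [ψ.symm_apply_eq, hu, φ.apply_symm_apply]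
  · rw [hm, φ.apply_symm_apply, φ.apply_symm_apply, φ.apply_symm_apply]

/-! An internal functor satisfies one half of each of the compatibilities with direct images; an
invertible one satisfies both. -/

theorem Hom.directImage_m_le (F : Hom C D) (hC : IsSemiopen C.m) (hD : IsSemiopen D.m)
    (a b : D.Arr) : directImage C.m (tmul C.d C.r (F.f₁ a) (F.f₁ b)) ≤
      F.f₁ (directImage D.m (tmul D.d D.r a b)) := by
  rw [directImage_gc hC]
  have h := DFunLike.congr_fun F.comm_m (directImage D.m (tmul D.d D.r a b))
  rw [FrameHom.comp_apply, FrameHom.comp_apply] at h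
  rw [← h]
  exact tmul_le_map (tmul_le.1 ((directImage_gc hD).le_u_l _)) le_rfl le_rfl

theorem Hom.directImage_u_le (F : Hom C D) (hC : IsSemiopen C.u) (hD : IsSemiopen D.u)
    (l : D.Obj) : directImage C.u (F.f₀ l) ≤ F.f₁ (directImage D.u l) := by
  rw [directImage_gc hC]
  refine (OrderHomClass.mono F.f₀ ((directImage_gc hD).le_u_l l)).trans_eq ?_
  exact DFunLike.congr_fun F.comm_u _

theorem Hom.directImage_d_le (F : Hom C D) (hC : IsSemiopen C.d) (hD : IsSemiopen D.d)
    (a : D.Arr) : directImage C.d (F.f₁ a) ≤ F.f₀ (directImage D.d a) := by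
  rw [directImage_gc hC]
  refine (OrderHomClass.mono F.f₁ ((directImage_gc hD).le_u_l a)).trans_eq ?_
  exact DFunLike.congr_fun F.comm_d _

theorem Hom.directImage_r_le (F : Hom C D) (hC : IsSemiopen C.r) (hD : IsSemiopen D.r)
    (a : D.Arr) : directImage C.r (F.f₁ a) ≤ F.f₀ (directImage D.r a) := by
  rw [directImage_gc hC]
  refine (OrderHomClass.mono F.f₁ ((directImage_gc hD).le_u_l a)).trans_eq ?_
  exact DFunLike.congr_fun F.comm_r _

theorem Isomorphic.toQuantalFrame (hC : C.IsQuantal) (hD : D.IsQuantal) (h : C.Isomorphic D) :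
    C.toQuantalFrame.Isomorphic D.toQuantalFrame := by
  obtain ⟨F, G, h₁, h₂, -, -⟩ := h
  have e₁ : ∀ a, F.f₁ (G.f₁ a) = a := DFunLike.congr_fun h₁
  have e₂ : ∀ a, G.f₁ (F.f₁ a) = a := DFunLike.congr_fun h₂
  let φ : C.Arr ≃o D.Arr :=
    { toFun := G.f₁
      invFun := F.f₁
      left_inv := e₁
      right_inv := e₂
      map_rel_iff' := fun {a b} =>
        ⟨fun h => by simpa only [e₁] using OrderHomClass.mono F.f₁ (show G.f₁ a ≤ G.f₁ b from h),
          fun h => OrderHomClass.mono G.f₁ h⟩ }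
  have hlam : ∀ {X Y : LocalicCatData.{u}} (H : Hom X Y), X.IsQuantal → Y.IsQuantal → ∀ a,
      directImage X.u (directImage X.d (H.f₁ a)) ≤ H.f₁ (directImage Y.u (directImage Y.d a)) :=
    fun H hX hY a => ((directImage_gc hX.u_open.1).monotone_l
      (H.directImage_d_le hX.d_open.1 hY.d_open.1 a)).trans
      (H.directImage_u_le hX.u_open.1 hY.u_open.1 _)
  have hrho : ∀ {X Y : LocalicCatData.{u}} (H : Hom X Y), X.IsQuantal → Y.IsQuantal → ∀ a,
      directImage X.u (directImage X.r (H.f₁ a)) ≤ H.f₁ (directImage Y.u (directImage Y.r a)) :=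
    fun H hX hY a => ((directImage_gc hX.u_open.1).monotone_l
      (H.directImage_r_le hX.r_open.1 hY.r_open.1 a)).trans
      (H.directImage_u_le hX.u_open.1 hY.u_open.1 _)
  refine ⟨φ, fun a b => le_antisymm ?_ ?_, le_antisymm ?_ ?_, fun a => le_antisymm ?_ ?_,
    fun a => le_antisymm ?_ ?_⟩
  · have h := OrderHomClass.mono G.f₁
      (F.directImage_m_le hC.m_semiopen hD.m_semiopen (G.f₁ a) (G.f₁ b))
    rwa [e₁, e₁, e₂] at h
  · exact G.directImage_m_le hD.m_semiopen hC.m_semiopen a b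
  · have h := OrderHomClass.mono G.f₁ (F.directImage_u_le hC.u_open.1 hD.u_open.1 ⊤)
    rwa [map_top, e₂] at h
  · have h := G.directImage_u_le hD.u_open.1 hC.u_open.1 ⊤
    rwa [map_top] at h
  · have h := OrderHomClass.mono G.f₁ (hlam F hC hD (G.f₁ a))
    rwa [e₁, e₂] at h
  · exact hlam G hD hC a
  · have h := OrderHomClass.mono G.f₁ (hrho F hC hD (G.f₁ a))
    rwa [e₁, e₂] at h
  · exact hrho G hD hC a

end LocalicCatData

namespace QuantalFrameData

variable {Q R : QuantalFrameData.{u}}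

theorem Isomorphic.symm : Q.Isomorphic R → R.Isomorphic Q := by
  rintro ⟨φ, h₁, h₂, h₃, h₄⟩
  refine ⟨φ.symm, fun a b => ?_, ?_, fun a => ?_, fun a => ?_⟩ <;> apply φ.injective <;>
    simp [*]

theorem Isomorphic.toLocalicCat (hQ : Q.IsEhresmann) (hR : R.IsEhresmann)
    (hmQ : Q.IsMultiplicative hQ) (hmR : R.IsMultiplicative hR) (h : Q.Isomorphic R) :
    (toLocalicCat hQ hmQ).Isomorphic (toLocalicCat hR hmR) := by
  obtain ⟨φ, hmul, he, -, -⟩ := h.symm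
  have mem_proj : ∀ a, a ≤ R.e ↔ φ a ≤ Q.e := fun a => by rw [← he, φ.le_iff_le]
  let ψ : R.Proj ≃o Q.Proj :=
    { toFun := fun f => ⟨φ f, (mem_proj f).1 f.2⟩
      invFun := fun f => ⟨φ.symm f, (mem_proj _).2 ((φ.apply_symm_apply _).trans_le f.2)⟩
      left_inv := fun f => Subtype.ext (φ.symm_apply_apply f)
      right_inv := fun f => Subtype.ext (φ.apply_symm_apply f)
      map_rel_iff' := φ.le_iff_le }
  refine LocalicCatData.isomorphic_of_orderIso φ ψ (fun f => ?_) (fun f => ?_)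
    (fun a => Subtype.ext ?_) (fun x y a => ?_)
  · change φ (⊤ * f.1) = ⊤ * φ f.1
    rw [hmul, φ.map_top]
  · change φ (f.1 * ⊤) = φ f.1 * ⊤
    rw [hmul, φ.map_top]
  · change φ (a ⊓ R.e) = φ a ⊓ Q.e
    rw [φ.map_inf, he]
  · change x * y ≤ a ↔ φ x * φ y ≤ φ a
    rw [← hmul, φ.le_iff_le]

end QuantalFrameData

namespace LocalicCatData

open LocaleMap FrameTensor QuantalFrameData

variable {C D : LocalicCatData.{u}}

/-- The projections of `𝒪(C)` are the direct images `u_!(l)` of the elements `l` of `O(C₀)`. -/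
def IsQuantal.projIso (hC : C.IsQuantal) : C.Obj ≃o C.toQuantalFrame.Proj where
  toFun l := ⟨directImage C.u l, (directImage_gc hC.u_open.1).monotone_l le_top⟩
  invFun a := C.u (a : C.Arr)
  left_inv l := hC.u_directImage_u l
  right_inv a := Subtype.ext (hC.directImage_u_u a.2)
  map_rel_iff' {l l'} := by
    change directImage C.u l ≤ directImage C.u l' ↔ _
    rw [directImage_gc hC.u_open.1, hC.u_directImage_u]

/-- `𝒞(𝒪(C)) ≃ C`: the identity on arrows and `l ↦ u_!(l)` on objects. -/
theorem IsEtale.isomorphic (hC : C.IsEtale) (hQ : C.toQuantalFrame.IsEhresmann)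
    (hm : C.toQuantalFrame.IsMultiplicative hQ) : (toLocalicCat hQ hm).Isomorphic C := by
  have hq := hC.isQuantal
  refine isomorphic_of_orderIso (OrderIso.refl C.Arr) hq.projIso (fun l => ?_) (fun l => ?_)
    (fun a => Subtype.ext ?_) (fun x y a => ?_)
  · exact (top_inf_eq _).symm.trans (hq.mul_directImage_u ⊤ l).symm
  · exact (inf_top_eq _).symm.trans (hq.directImage_u_mul ⊤ l).symm
  · have h := hq.u_open.2 ⊤ a
    rw [top_inf_eq, inf_comm] at h
    exact h
  · exact tmul_le.symm.trans (directImage_gc hq.m_semiopen _ _).symm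

theorem IsEtale.isMultiplicative (hC : C.IsEtale) (hQ : C.toQuantalFrame.IsEhresmann) :
    C.toQuantalFrame.IsMultiplicative hQ :=
  hC.toQuantalFrame_isEtale.isMultiplicative hQ hC.toQuantalFrame_isRestriction.pi_closed

end LocalicCatData

theorem mainTheorem3 :
    -- An étale Ehresmann quantal frame has multiplicatively closed partial isometries iff it is
    -- strongly multiplicative.
    (∀ (Q : QuantalFrameData.{u}) (hQ : Q.IsEhresmann), Q.IsEtale →
      (Q.PIClosed ↔ Q.IsStronglyMultiplicative hQ)) ∧
    -- `𝒞(Q)` is defined and an étale localic category iff `Q` is a restriction quantal frame.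
    (∀ (Q : QuantalFrameData.{u}) (hQ : Q.IsEhresmann),
      Q.IsRestriction ↔
        ∃ hm : Q.IsMultiplicative hQ, (QuantalFrameData.toLocalicCat hQ hm).IsEtale) ∧
    -- A quantal localic category `C` is étale iff `𝒪(C)` is a restriction quantal frame.
    (∀ C : LocalicCatData.{u}, C.IsQuantal → (C.IsEtale ↔ C.toQuantalFrame.IsRestriction)) ∧
    -- `𝒪(𝒞(Q)) = Q`
    (∀ (Q : QuantalFrameData.{u}) (hQ : Q.IsEhresmann) (hm : Q.IsMultiplicative hQ),
      Q.IsRestriction → (QuantalFrameData.toLocalicCat hQ hm).toQuantalFrame = Q) ∧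
    -- `𝒞(𝒪(C)) ≃ C`
    (∀ (C : LocalicCatData.{u}), C.IsEtale →
      ∃ (hQ : C.toQuantalFrame.IsEhresmann) (hm : C.toQuantalFrame.IsMultiplicative hQ),
        (QuantalFrameData.toLocalicCat hQ hm).Isomorphic C) ∧
    -- Both constructions preserve and reflect isomorphism.
    (∀ (Q R : QuantalFrameData.{u}) (hQ : Q.IsEhresmann) (hR : R.IsEhresmann)
      (hmQ : Q.IsMultiplicative hQ) (hmR : R.IsMultiplicative hR),
      Q.IsRestriction → R.IsRestriction →
      (Q.Isomorphic R ↔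
        (QuantalFrameData.toLocalicCat hQ hmQ).Isomorphic
          (QuantalFrameData.toLocalicCat hR hmR))) ∧
    (∀ C D : LocalicCatData.{u}, C.IsEtale → D.IsEtale →
      (C.Isomorphic D ↔ C.toQuantalFrame.Isomorphic D.toQuantalFrame)) := by
  refine ⟨fun Q hQ he => QuantalFrameData.isStronglyMultiplicative_iff hQ he,
    fun Q hQ => QuantalFrameData.isRestriction_iff hQ, fun C hC => hC.isEtale_iff,
    fun Q hQ hm _ => QuantalFrameData.toQuantalFrame_toLocalicCat hQ hm, fun C hC => ?_,
    fun Q R hQ hR hmQ hmR _ _ => ⟨fun h => h.toLocalicCat hQ hR hmQ hmR, fun h => ?_⟩,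
    fun C D hC hD => ⟨fun h => h.toQuantalFrame hC.isQuantal hD.isQuantal, fun h => ?_⟩⟩
  · have hQ := hC.toQuantalFrame_isRestriction.toIsEhresmann
    exact ⟨hQ, hC.isMultiplicative hQ, hC.isomorphic hQ _⟩
  · have := h.toQuantalFrame (QuantalFrameData.isQuantal_toLocalicCat hQ hmQ)
      (QuantalFrameData.isQuantal_toLocalicCat hR hmR)
    rwa [QuantalFrameData.toQuantalFrame_toLocalicCat,
      QuantalFrameData.toQuantalFrame_toLocalicCat] at this
  · have hQC := hC.toQuantalFrame_isRestriction.toIsEhresmann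
    have hQD := hD.toQuantalFrame_isRestriction.toIsEhresmann
    have hmC := hC.isMultiplicative hQC
    have hmD := hD.isMultiplicative hQD
    exact (hC.isomorphic hQC hmC).symm.trans
      ((h.toLocalicCat hQC hQD hmC hmD).trans (hD.isomorphic hQD hmD))
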